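/- **Setting.** Let $d\ge 2$ and let $\Omega\subset\mathbb{R}^d$ be a bounded polytopal domain (nonempty, open, connected) with a regular simplicial partition $\mathcal{T}$: a finite set of open $d$-simplices (interiors of convex hulls of $d+1$ affinely independent points) which are pairwise disjoint, satisfy $\overline\Omega=\bigcup_{T\in\mathcal{T}}\overline T$, and are such that for distinct $T,T'\in\mathcal{T}$ the set $\overline T\cap\overline{T'}$ is empty or a closed proper subsimplex of $T$ (hence of both). Let $\mathcal{V}$ be the set of vertices of $\mathcal{T}$, $s(p):=|\{T\in\mathcal{T}: p\in\overline T\}|$ for $p\in\mathcal{V}$, and $\mathfrak{s}(\mathcal{V}):=\max_{p\in\mathcal{V}}s(p)$. Let $S^1(\mathcal{T},\Omega)$ be the vector space of continuous, piecewise linear functions, i.e. of the $v\in H^1(\Omega)\cap C(\overline\Omega)$ such that $v|_T$ is a polynomial of degree at most $1$ for every $T\in\mathcal{T}$. It has a basis of hat functions $\{\theta_p\}_{p\in\mathcal{V}}$, determined by $\theta_p(q)=\delta_{pq}$ for $p,q\in\mathcal{V}$, so that $\dim S^1(\mathcal{T},\Omega)=|\mathcal{V}|$. A neural network $\Phi=((A_1,b_1,\varrho_1),\dots,(A_L,b_L,\varrho_L))$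 with layer dimensions $N_0,\dots,N_L\ge 1$ consists of matrices $A_\ell\in\mathbb{R}^{N_\ell\times N_{\ell-1}}$, vectors $b_\ell\in\mathbb{R}^{N_\ell}$ and lists $\varrho_\ell$ of $N_\ell$ activation functions acting componentwise, with $\varrho_L=\mathrm{Id}$. Its realization is $\mathrm{R}(\Phi):x_0\mapsto x_L$ with $x_\ell=\varrho_\ell(A_\ell x_{\ell-1}+b_\ell)$, its depth is $L(\Phi)=L$, and its size $M(\Phi)$ is the total number of nonzero entries of all $A_\ell$ and $b_\ell$. It is a ReLU network if all activations in the layers $1,\dots,L-1$ equal $x\mapsto\max\{0,x\}$. **Proposition.** There are constants $C,C'>0$, independent of $d$, $\Omega$ and $\mathcal{T}$, such that for all $d$, $\Omega$, $\mathcal{T}$ as above the following holds. 1. There is a ReLU network $\Phi^{CPwL}$ with input dimension $d$ and output dimension $|\mathcal{V}|$ such that $\mathrm{R}(\Phi^{CPwL})(x)_p=\theta_p(x)$ for all $x\in\overline\Omega$ and all $p\in\mathcal{V}$, and $$L(\Phi^{CPwL})\le 8+\log_2\mathfrak{s}(\mathcal{V})+\log_2(d+1),$$ $$M(\Phi^{CPwL})\le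 C|\mathcal{V}|\log_2\mathfrak{s}(\mathcal{V})+Cd^2\sum_{p\in\mathcal{V}}s(p)\le C'd^2\,\mathfrak{s}(\mathcal{V})\dim S^1(\mathcal{T},\Omega).$$ 2. For every $v\in S^1(\mathcal{T},\Omega)$ there is a ReLU network $\Phi^{CPwL,v}$ with input dimension $d$ and output dimension $1$ such that $\mathrm{R}(\Phi^{CPwL,v})(x)=v(x)$ for all $x\in\overline\Omega$, with the same bounds on $L(\Phi^{CPwL,v})$ and $M(\Phi^{CPwL,v})$. 3. The layer dimensions and the lists of activation functions of $\Phi^{CPwL}$ and of $\Phi^{CPwL,v}$ are independent of $v$ and, for given $d$, depend on $\mathcal{T}$ only through the family $\{s(p)\}_{p\in\mathcal{V}}$ (and hence $|\mathcal{V}|$). 4. The set $\{\Phi^{CPwL,v}: v\in S^1(\mathcal{T},\Omega)\}$ with the operation $\Phi^{CPwL,v}\,\widehat{+}\,\lambda\Phi^{CPwL,w}:=\Phi^{CPwL,v+\lambda w}$ ($v,w\in S^1(\mathcal{T},\Omega)$, $\lambda\in\mathbb{R}$) is a vector space, and the realization map $\Phi^{CPwL,v}\mapsto \mathrm{R}(\Phi^{CPwL,v})|_{\overline\Omega}$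 is a linear isomorphism from it onto $S^1(\mathcal{T},\Omega)$. -/

import Mathlib

open MeasureTheory
open scoped ContDiff

noncomputable section

/-! ### Simplicial partitions of a domain -/

/-- The open convex hull of a finite set of points (strictly positive weights). -/
def openConv {d : ℕ} (Y : Finset (Fin d → ℝ)) : Set (Fin d → ℝ) :=
  {x | ∃ w : (Fin d → ℝ) → ℝ, (∀ y ∈ Y, 0 < w y) ∧ ∑ y ∈ Y, w y = 1 ∧ ∑ y ∈ Y, w y • y = x}

/-- A (finite) regular simplicial partition of `Ω ⊆ ℝ^d` into `d`-simplices.  A simplex is given by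
its set `T` of `d + 1` affinely independent vertices; the open simplex is `openConv T`, its closure
is `convexHull ℝ T`. -/
structure RegularMesh {d : ℕ} (Ω : Set (Fin d → ℝ)) where
  /-- the vertex sets of the simplices -/
  cells : Finset (Finset (Fin d → ℝ))
  card_cell : ∀ T ∈ cells, T.card = d + 1
  affineIndependent_cell : ∀ T ∈ cells, AffineIndependent ℝ (fun a : T => (a : Fin d → ℝ))
  closure_eq : closure Ω = ⋃ T ∈ cells, convexHull ℝ (T : Set (Fin d → ℝ))
  disjoint_cells : ∀ T ∈ cells, ∀ T' ∈ cells, T ≠ T' → Disjoint (openConv T) (openConv T')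
  /-- Two distinct closed simplices meet in a (possibly empty) closed proper subsimplex of the
  first one, hence, by symmetry, of both. -/
  regular : ∀ T ∈ cells, ∀ T' ∈ cells, T ≠ T' → ∃ F, F ⊂ T ∧
    convexHull ℝ (T : Set (Fin d → ℝ)) ∩ convexHull ℝ (T' : Set (Fin d → ℝ)) =
      convexHull ℝ (F : Set (Fin d → ℝ))

namespace RegularMesh

variable {d : ℕ} {Ω : Set (Fin d → ℝ)}

/-- The set `𝒱` of vertices. -/
def vertices (𝒯 : RegularMesh Ω) : Finset (Fin d → ℝ) :=
  𝒯.cells.biUnion id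

open Classical in
/-- `s(p)`: the number of simplices whose closure contains `p`. -/
def s (𝒯 : RegularMesh Ω) (p : Fin d → ℝ) : ℕ :=
  (𝒯.cells.filter (fun T => p ∈ convexHull ℝ (T : Set (Fin d → ℝ)))).card

/-- `𝔰(𝒱)`: the maximum of `s(p)` over all vertices. -/
def sMax (𝒯 : RegularMesh Ω) : ℕ :=
  𝒯.vertices.sup 𝒯.s

/-- The family `(s(p))_{p ∈ 𝒱}`, as a multiset. -/
def sFamily (𝒯 : RegularMesh Ω) : Multiset ℕ :=
  𝒯.vertices.val.map 𝒯.s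

theorem vertex_mem_closure (𝒯 : RegularMesh Ω) {p : Fin d → ℝ} (hp : p ∈ 𝒯.vertices) :
    p ∈ closure Ω := by
  obtain ⟨T, hT, hpT⟩ := Finset.mem_biUnion.1 hp
  rw [𝒯.closure_eq]
  exact Set.mem_biUnion hT (subset_convexHull ℝ _ hpT)

/-- A vertex as a point of the closure of `Ω`. -/
def vertexPt (𝒯 : RegularMesh Ω) (p : 𝒯.vertices) : closure Ω :=
  ⟨p.1, 𝒯.vertex_mem_closure p.2⟩

end RegularMesh

/-! ### The Sobolev space `H¹(Ω)` and the space of continuous, piecewise linear functions -/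

/-- `g` is the weak `i`-th partial derivative of `u` on the open set `Ω`. -/
def HasWeakPartialDeriv {d : ℕ} (Ω : Set (Fin d → ℝ)) (i : Fin d)
    (u g : (Fin d → ℝ) → ℝ) : Prop :=
  ∀ φ : (Fin d → ℝ) → ℝ, ContDiff ℝ ∞ φ → HasCompactSupport φ → tsupport φ ⊆ Ω →
    ∫ x in Ω, u x * fderiv ℝ φ x (Pi.single i 1) = -∫ x in Ω, g x * φ x

/-- `u ∈ H¹(Ω)`: `u` and its weak partial derivatives are in `L²(Ω)`. -/
def MemH1 {d : ℕ} (Ω : Set (Fin d → ℝ)) (u : (Fin d → ℝ) → ℝ) : Prop :=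
  MemLp u 2 (volume.restrict Ω) ∧
    ∀ i, ∃ g, MemLp g 2 (volume.restrict Ω) ∧ HasWeakPartialDeriv Ω i u g

theorem memH1_zero {d : ℕ} (Ω : Set (Fin d → ℝ)) : MemH1 Ω 0 :=
  ⟨MemLp.zero, fun i => ⟨0, MemLp.zero, fun φ _ _ _ => by simp⟩⟩

theorem MemH1.smul {d : ℕ} {Ω : Set (Fin d → ℝ)} {u : (Fin d → ℝ) → ℝ} (c : ℝ)
    (hu : MemH1 Ω u) : MemH1 Ω (c • u) := by
  refine ⟨hu.1.const_smul c, fun i => ?_⟩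
  obtain ⟨g, hg, hug⟩ := hu.2 i
  refine ⟨c • g, hg.const_smul c, fun φ h1 h2 h3 => ?_⟩
  simp only [Pi.smul_apply, smul_eq_mul, mul_assoc, integral_const_mul]
  rw [hug φ h1 h2 h3]
  ring

theorem MemH1.add {d : ℕ} {Ω : Set (Fin d → ℝ)} {u v : (Fin d → ℝ) → ℝ}
    (hu : MemH1 Ω u) (hv : MemH1 Ω v) : MemH1 Ω (u + v) := by
  refine ⟨hu.1.add hv.1, fun i => ?_⟩
  obtain ⟨g, hg, hug⟩ := hu.2 i
  obtain ⟨h, hh, hvh⟩ := hv.2 i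
  refine ⟨g + h, hg.add hh, fun φ h1 h2 h3 => ?_⟩
  have key : ∀ (f ψ : (Fin d → ℝ) → ℝ), MemLp f 2 (volume.restrict Ω) → Continuous ψ →
      HasCompactSupport ψ → Integrable (fun x => f x * ψ x) (volume.restrict Ω) := by
    intro f ψ hf hc hs
    have hψ : MemLp ψ 2 (volume.restrict Ω) := (hc.memLp_of_hasCompactSupport hs).restrict Ω
    exact hf.integrable_mul hψ
  have hφ' : Continuous (fun x => fderiv ℝ φ x (Pi.single i 1)) :=
    (h1.continuous_fderiv (by simp)).clm_apply continuous_const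
  have hs' : HasCompactSupport (fun x => fderiv ℝ φ x (Pi.single i 1)) :=
    h2.fderiv_apply (𝕜 := ℝ) (Pi.single i 1)
  simp only [Pi.add_apply, add_mul]
  rw [integral_add (key u _ hu.1 hφ' hs') (key v _ hv.1 hφ' hs'),
    integral_add (key g _ hg h1.continuous h2) (key h _ hh h1.continuous h2),
    hug φ h1 h2 h3, hvh φ h1 h2 h3]
  ring

/-- The space `S¹(𝒯, Ω)` of continuous, piecewise linear functions: the functions in `H¹(Ω)`,
continuous up to the boundary of `Ω`, that are affine on every open simplex of `𝒯`. -/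
def S1 {d : ℕ} {Ω : Set (Fin d → ℝ)} (𝒯 : RegularMesh Ω) : Submodule ℝ C(closure Ω, ℝ) where
  carrier := {v | MemH1 Ω (Function.extend Subtype.val v 0) ∧
    ∀ T ∈ 𝒯.cells, ∃ f : (Fin d → ℝ) →ᵃ[ℝ] ℝ,
      ∀ x : closure Ω, (x : Fin d → ℝ) ∈ openConv T → v x = f x}
  zero_mem' := by
    refine ⟨?_, fun T _ => ⟨0, fun x _ => by simp⟩⟩
    convert memH1_zero Ω
    ext x
    by_cases hx : ∃ a : closure Ω, (a : Fin d → ℝ) = x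
    · obtain ⟨a, rfl⟩ := hx
      rw [Subtype.val_injective.extend_apply]; rfl
    · rw [Function.extend_apply' _ _ _ hx]
  add_mem' := by
    rintro v w ⟨hv, hv'⟩ ⟨hw, hw'⟩
    refine ⟨?_, fun T hT => ?_⟩
    · have := Function.extend_add (Subtype.val : closure Ω → _) v w 0 0
      rw [add_zero] at this
      rw [ContinuousMap.coe_add, this]
      exact hv.add hw
    · obtain ⟨f, hf⟩ := hv' T hT
      obtain ⟨g, hg⟩ := hw' T hT
      exact ⟨f + g, fun x hx => by simp [hf x hx, hg x hx]⟩
  smul_mem' := by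
    rintro c v ⟨hv, hv'⟩
    refine ⟨?_, fun T hT => ?_⟩
    · have := Function.extend_smul c (Subtype.val : closure Ω → _) v 0
      rw [smul_zero] at this
      rw [ContinuousMap.coe_smul, this]
      exact hv.smul c
    · obtain ⟨f, hf⟩ := hv' T hT
      exact ⟨c • f, fun x hx => by simp [hf x hx]⟩

/-! ### Neural networks -/

/-- A feedforward neural network with input dimension `n` and output dimension `m`: a sequence of
layers, each with a weight matrix and a bias vector and, for all but the last layer, with one
activation function per neuron. -/
inductive NeuralNet : ℕ → ℕ → Type
  | output {n m : ℕ} (A : Matrix (Fin m) (Fin n) ℝ) (b : Fin m → ℝ) : NeuralNet n m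
  | hidden {n k m : ℕ} (hk : 0 < k) (A : Matrix (Fin k) (Fin n) ℝ) (b : Fin k → ℝ)
      (ϱ : Fin k → ℝ → ℝ) (Ψ : NeuralNet k m) : NeuralNet n m

/-- The activation function `ρ(x) = max {0, x}`. -/
def relu (x : ℝ) : ℝ := max 0 x

/-- The number of nonzero components of a weight matrix and a bias vector. -/
def layerSize {n m : ℕ} (A : Matrix (Fin m) (Fin n) ℝ) (b : Fin m → ℝ) : ℕ :=
  (Finset.univ.filter (fun ij : Fin m × Fin n => A ij.1 ij.2 ≠ 0)).card +
    (Finset.univ.filter (fun i => b i ≠ 0)).card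

namespace NeuralNet

/-- The realization of a network. -/
def realization : {n m : ℕ} → NeuralNet n m → (Fin n → ℝ) → (Fin m → ℝ)
  | _, _, output A b, x => A.mulVec x + b
  | _, _, hidden _ A b ϱ Ψ, x => Ψ.realization (fun i => ϱ i ((A.mulVec x + b) i))

/-- The depth `L`, the number of layers. -/
def depth : {n m : ℕ} → NeuralNet n m → ℕ
  | _, _, output _ _ => 1
  | _, _, hidden _ _ _ _ Ψ => Ψ.depth + 1

/-- The size `M`, the total number of nonzero weights and biases. -/
def size : {n m : ℕ} → NeuralNet n m → ℕ
  | _, _, output A b => layerSize A b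
  | _, _, hidden _ A b _ Ψ => layerSize A b + Ψ.size

/-- The layer dimensions `[N_0, …, N_L]`. -/
def layerDims : {n m : ℕ} → NeuralNet n m → List ℕ
  | n, m, output _ _ => [n, m]
  | n, _, hidden _ _ _ _ Ψ => n :: Ψ.layerDims

/-- The lists of activation functions `[ϱ_1, …, ϱ_L]`, where `ϱ_L` is the identity. -/
def activations : {n m : ℕ} → NeuralNet n m → List (List (ℝ → ℝ))
  | _, m, output _ _ => [List.replicate m id]
  | _, _, hidden _ _ _ ϱ Ψ => List.ofFn ϱ :: Ψ.activations

/-- All activations in the hidden layers are `relu`. -/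
def IsReLU : {n m : ℕ} → NeuralNet n m → Prop
  | _, _, output _ _ => True
  | _, _, hidden _ _ _ ϱ Ψ => (∀ i, ϱ i = relu) ∧ Ψ.IsReLU

end NeuralNet

end

/-! On each cell `T'`, the hat function at `p` is the barycentric coordinate `lam T' p` (zero if `p
∉ T'`). The key fact is that, for one sufficiently large `M`, on the closure of `Ω` θ_p = max over
cells T containing p of min over i in T of relu (λ_{T,p} + M λ_{T,i}), where the term `i = p` is
read as λ_{T,p}. On `T` all coordinates are nonnegative, so its minimum is exactly λ_{T,p}. On
another cell `T'` the minimum belonging to `T` must not exceed λ_{T',p}, although the star of `p`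
need not be convex. Let σ be the barycentric weight of `x` on the vertices of `T'` outside `T`. Then
λ_{T,p} - λ_{T',p} ≤ K σ, while some facet of `T` through the common face separates, λ_{T,i}(x) ≤ -c
σ, with `c > 0` by compactness; hence `M ≥ K / c` suffices (`IsBarycentric.exists_apply_neg`,
`IsBarycentric.eventually_le_or_exists_add_mul_le`, `RegularMesh.exists_maxMin_eq_barycentric`).

The formula also defines a Lipschitz function on the whole space, so the hat functions lie in H¹.
Together with nodal interpolation this makes them a basis (`RegularMesh.exists_hat_basis`).

Maxima and minima are computed along binary trees, with two neurons per node, because all values in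
the trees are nonnegative (`Emulates.comb`, `Emulates.tree`). Trees are padded to a power of two, so
the dimensions depend only on `d`, the output dimension, `|𝒱|` and the maximal `s(p)`. Padding
leaves carry the value zero and no nonzero weights, so the size is governed by the sum of the
`s(p)`, up to rounding by one node per level, which causes the term `|𝒱| log₂ 𝔰(𝒱)`.

The output matrix is free (`exists_maxMin_network`): a permutation matrix gives all hat functions,
the row of nodal values gives `v`. Since `v` can be recovered from the realization, the vector space
structure on the networks is transported from `S1 𝒯`. -/

noncomputable section

/-! ### Counting nonzero weights -/

/-- The number of nonzero entries of a matrix. -/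
def nnz {ι κ : Type} [Fintype ι] [Fintype κ] (A : Matrix ι κ ℝ) : ℕ :=
  (Finset.univ.filter (fun ij : ι × κ => A ij.1 ij.2 ≠ 0)).card

/-- The number of nonzero entries of a row of the augmented matrix `(B | c)`. -/
def rowNnz {ι κ : Type} [Fintype κ] (B : Matrix ι κ ℝ) (c : ι → ℝ) (j : ι) : ℕ :=
  (Finset.univ.filter (fun l => B j l ≠ 0)).card + if c j ≠ 0 then 1 else 0

theorem rowNnz_zero_right {ι κ : Type} [Fintype κ] (B : Matrix ι κ ℝ) (j : ι) :
    rowNnz B 0 j = (Finset.univ.filter (fun l => B j l ≠ 0)).card := by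
  simp [rowNnz]

theorem rowNnz_le_card_add_one {ι κ : Type} [Fintype κ] (B : Matrix ι κ ℝ) (c : ι → ℝ) (j : ι) :
    rowNnz B c j ≤ Fintype.card κ + 1 := by
  unfold rowNnz
  have h := Finset.card_le_univ (Finset.univ.filter (fun l => B j l ≠ 0))
  split_ifs <;> omega

theorem card_support_mul_le {ι κ μ : Type} [Fintype ι] [Fintype κ] [Fintype μ]
    (A : Matrix ι κ ℝ) (B : Matrix κ μ ℝ) :
    (Finset.univ.filter (fun il : ι × μ => (A * B) il.1 il.2 ≠ 0)).card ≤
      ∑ ij ∈ Finset.univ.filter (fun ij : ι × κ => A ij.1 ij.2 ≠ 0),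
        (Finset.univ.filter (fun l => B ij.2 l ≠ 0)).card := by
  classical
  refine (Finset.card_le_card (t := (Finset.univ.filter
    (fun ij : ι × κ => A ij.1 ij.2 ≠ 0)).biUnion
      (fun ij => {ij.1} ×ˢ Finset.univ.filter (fun l => B ij.2 l ≠ 0))) ?_).trans
      (Finset.card_biUnion_le.trans (Finset.sum_le_sum fun ij _ => by simp))
  rintro ⟨i, l⟩ h
  rw [Finset.mem_filter, Matrix.mul_apply] at h
  replace h := h.2
  obtain ⟨j, -, hj⟩ := Finset.exists_ne_zero_of_sum_ne_zero h
  simp only [Finset.mem_biUnion, Finset.mem_filter, Finset.mem_univ, true_and, Finset.mem_product,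
    Finset.mem_singleton]
  exact ⟨(i, j), left_ne_zero_of_mul hj, rfl, right_ne_zero_of_mul hj⟩

theorem card_support_mulVec_le {ι κ : Type} [Fintype ι] [Fintype κ]
    (A : Matrix ι κ ℝ) (c : κ → ℝ) :
    (Finset.univ.filter (fun i => (A.mulVec c) i ≠ 0)).card ≤
      ∑ ij ∈ Finset.univ.filter (fun ij : ι × κ => A ij.1 ij.2 ≠ 0),
        if c ij.2 ≠ 0 then 1 else 0 := by
  classical
  rw [← Finset.card_filter, Finset.filter_filter]
  refine (Finset.card_le_card ?_).trans (Finset.card_image_le (f := Prod.fst))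
  intro i h
  rw [Finset.mem_filter, Matrix.mulVec, dotProduct] at h
  replace h := h.2
  obtain ⟨j, -, hj⟩ := Finset.exists_ne_zero_of_sum_ne_zero h
  simp only [Finset.mem_image, Finset.mem_filter, Finset.mem_univ, true_and]
  exact ⟨(i, j), ⟨left_ne_zero_of_mul hj, right_ne_zero_of_mul hj⟩, rfl⟩

/-- Each nonzero entry of `A` contributes at most one row of `(B | c)` to the support of the
product. -/
theorem layerSize_mul_le {J : Type} [Fintype J] {n m r : ℕ} (A : Matrix (Fin m) J ℝ)
    (B : Matrix J (Fin n) ℝ) (c : J → ℝ) (h : ∀ j, rowNnz B c j ≤ r) :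
    layerSize (A * B) (A.mulVec c) ≤ r * nnz A := by
  refine (add_le_add (card_support_mul_le A B) (card_support_mulVec_le A c)).trans ?_
  rw [← Finset.sum_add_distrib, nnz, mul_comm]
  exact (Finset.sum_le_card_nsmul _ _ r fun ij _ => h ij.2)

theorem nnz_submatrix {ι κ ι' : Type} [Fintype ι] [Fintype κ] [Fintype ι']
    (A : Matrix ι κ ℝ) (e : ι' ≃ ι) : nnz (A.submatrix e id) = nnz A := by
  refine Finset.card_bij (fun ij _ => (e ij.1, ij.2)) ?_ ?_ ?_
  · intro ij h
    rw [Finset.mem_filter] at h ⊢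
    exact ⟨Finset.mem_univ _, h.2⟩
  · rintro ⟨a, b⟩ _ ⟨a', b'⟩ _ h; simpa using h
  · rintro ⟨i, j⟩ h
    refine ⟨(e.symm i, j), ?_, by simp⟩
    rw [Finset.mem_filter] at h ⊢
    simpa using h

/-! ### Emulation of functions by ReLU networks, up to a preceding affine map -/

/-- For every affine map `x ↦ B x + c` all of whose rows have at most `r` nonzero weights,
`x ↦ F (B x + c)` is emulated, where `B x + c ∈ D`, by a ReLU network with layer dimensions `dims`
after the input, of size at most `r * a + b`.  Here `a` accounts for the first layer and `b` for the
others. -/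
def Emulates {J : Type} {m : ℕ} (D : Set (J → ℝ))
    (F : (J → ℝ) → Fin m → ℝ) (dims : List ℕ) (a b : ℕ) : Prop :=
  ∀ (n r : ℕ) (B : Matrix J (Fin n) ℝ) (c : J → ℝ), (∀ j, rowNnz B c j ≤ r) →
    ∃ Φ : NeuralNet n m, Φ.IsReLU ∧ Φ.layerDims = n :: dims ∧ Φ.size ≤ r * a + b ∧
      ∀ x, B.mulVec x + c ∈ D → Φ.realization x = F (B.mulVec x + c)

theorem emulates_linear {J : Type} [Fintype J] {m : ℕ} (W : Matrix (Fin m) J ℝ)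
    (D : Set (J → ℝ)) : Emulates D (fun v => W.mulVec v) [m] (nnz W) 0 := by
  intro n r B c h
  refine ⟨.output (W * B) (W.mulVec c), trivial, rfl, layerSize_mul_le W B c h, fun x _ => ?_⟩
  simp [NeuralNet.realization, Matrix.mulVec_add, Matrix.mulVec_mulVec]

/-- The linear output `B'` of the new layer is absorbed into the first layer of the remaining
network. This is why `Emulates` quantifies over all preceding affine maps: networks compose without
extra layers. -/
theorem Emulates.hidden {J J' K : Type} [Fintype J] [Fintype K] [Nonempty K] {m : ℕ}
    {D' : Set (J' → ℝ)} {F' : (J' → ℝ) → Fin m → ℝ} {dims : List ℕ} {a b r' : ℕ}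
    (H : Emulates D' F' dims a b) (A : Matrix K J ℝ) (B' : Matrix J' K ℝ)
    (hB' : ∀ j, rowNnz B' 0 j ≤ r') {D : Set (J → ℝ)} {F : (J → ℝ) → Fin m → ℝ}
    (hD : ∀ v ∈ D, B'.mulVec (fun i => relu (A.mulVec v i)) ∈ D')
    (hF : ∀ v ∈ D, F v = F' (B'.mulVec (fun i => relu (A.mulVec v i)))) :
    Emulates D F (Fintype.card K :: dims) (nnz A) (r' * a + b) := by
  intro n r B c h
  set e := Fintype.equivFin K
  have hrow : ∀ j, rowNnz (B'.submatrix id e.symm) 0 j ≤ r' := by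
    intro j
    refine le_trans (le_of_eq ?_) (hB' j)
    rw [rowNnz_zero_right, rowNnz_zero_right]
    refine Finset.card_bij (fun l _ => e.symm l) ?_ ?_ ?_
    · intro l hl
      rw [Finset.mem_filter] at hl ⊢
      exact ⟨Finset.mem_univ _, hl.2⟩
    · intro l _ l' _ hl; simpa using hl
    · intro l hl
      refine ⟨e l, ?_, by simp⟩
      rw [Finset.mem_filter] at hl ⊢
      simpa using hl
  obtain ⟨Ψ, h1, h2, h3, h4⟩ := H _ r' (B'.submatrix id e.symm) 0 hrow
  refine ⟨.hidden Fintype.card_pos (A.submatrix e.symm id * B) ((A.submatrix e.symm id).mulVec c)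
    (fun _ => relu) Ψ, by simp [NeuralNet.IsReLU, h1], by simp [NeuralNet.layerDims, h2], ?_, fun x hx => ?_⟩
  · have := layerSize_mul_le (A.submatrix e.symm id) B c h
    rw [nnz_submatrix] at this
    simp only [NeuralNet.size]
    omega
  · have key : (B'.submatrix id e.symm).mulVec (fun i => relu (((A.submatrix e.symm id *
        B).mulVec x + (A.submatrix e.symm id).mulVec c) i)) + 0 =
        B'.mulVec (fun i => relu (A.mulVec (B.mulVec x + c) i)) := by
      rw [add_zero, ← Matrix.mulVec_mulVec, ← Matrix.mulVec_add]
      ext j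
      simp only [Matrix.mulVec, dotProduct, Matrix.submatrix_apply, id]
      exact Equiv.sum_comp e.symm (fun k => B' j k * relu (∑ i, A k i * (B.mulVec x + c) i))
    rw [NeuralNet.realization, h4 _ (by rw [key]; exact hD _ hx), key, hF _ hx]

theorem Emulates.reindex {J J' : Type} {m : ℕ} {D : Set (J → ℝ)} {F : (J → ℝ) → Fin m → ℝ}
    {dims : List ℕ} {a b : ℕ} (H : Emulates D F dims a b) (e : J ≃ J') :
    Emulates {v | v ∘ e ∈ D} (fun v => F (v ∘ e)) dims a b := by
  intro n r B c h
  exact H n r (B.submatrix e id) (c ∘ e) fun j => h (e j)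

theorem Emulates.congr {J : Type} {m : ℕ} {D D' : Set (J → ℝ)} {F F' : (J → ℝ) → Fin m → ℝ}
    {dims : List ℕ} {a b : ℕ} (H : Emulates D F dims a b) (hD : D' ⊆ D)
    (hF : ∀ v ∈ D', F' v = F v) : Emulates D' F' dims a b := by
  intro n r B c h
  obtain ⟨Φ, h1, h2, h3, h4⟩ := H n r B c h
  exact ⟨Φ, h1, h2, h3, fun x hx => (h4 x (hD hx)).trans (hF _ hx).symm⟩

theorem Emulates.mono {J : Type} {m : ℕ} {D : Set (J → ℝ)} {F : (J → ℝ) → Fin m → ℝ}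
    {dims : List ℕ} {a b a' b' : ℕ} (H : Emulates D F dims a b) (ha : a ≤ a') (hb : b ≤ b') :
    Emulates D F dims a' b' := by
  intro n r B c h
  obtain ⟨Φ, h1, h2, h3, h4⟩ := H n r B c h
  exact ⟨Φ, h1, h2, h3.trans (by gcongr), h4⟩

/-! ### Binary trees of maxima and minima -/

/-- The maximum of `a` and `b` if `σ = 1`, their minimum if `σ = -1`. -/
def comb (σ a b : ℝ) : ℝ := a + σ * relu (σ * (b - a))

theorem comb_one (a b : ℝ) : comb 1 a b = max a b := by
  simp only [comb, relu, one_mul]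
  rcases le_total a b with h | h
  · rw [max_eq_right (by linarith), max_eq_right h]; ring
  · rw [max_eq_left (by linarith), max_eq_left h]; ring

theorem comb_neg_one (a b : ℝ) : comb (-1) a b = min a b := by
  simp only [comb, relu]
  rcases le_total a b with h | h
  · rw [max_eq_left (by linarith), min_eq_left h]; ring
  · rw [max_eq_right (by linarith), min_eq_right h]; ring

theorem comb_zero_zero (σ : ℝ) : comb σ 0 0 = 0 := by simp [comb, relu]

theorem comb_nonneg {σ a b : ℝ} (hσ : σ = 1 ∨ σ = -1) (ha : 0 ≤ a) (hb : 0 ≤ b) :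
    0 ≤ comb σ a b := by
  rcases hσ with rfl | rfl
  · rw [comb_one]; exact le_max_of_le_left ha
  · rw [comb_neg_one]; exact le_min ha hb

/-- The maximum (`σ = 1`) or minimum (`σ = -1`) of `2 ^ r` numbers, computed along a binary tree. -/
def treeFold (σ : ℝ) : (r : ℕ) → (Fin (2 ^ r) → ℝ) → ℝ
  | 0, v => v 0
  | r + 1, v => treeFold σ r fun i =>
      comb σ (v (finProdFinEquiv (i, (0 : Fin 2)))) (v (finProdFinEquiv (i, (1 : Fin 2))))

theorem fin_two_pow_zero (i : Fin (2 ^ 0)) : i = 0 := by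
  ext
  simp

theorem forall_fin_two_pow_succ {r : ℕ} {P : Fin (2 ^ (r + 1)) → Prop} :
    (∀ i, P i) ↔ ∀ i : Fin (2 ^ r), P (finProdFinEquiv (i, (0 : Fin 2))) ∧
      P (finProdFinEquiv (i, (1 : Fin 2))) := by
  refine ⟨fun h i => ⟨h _, h _⟩, fun h i => ?_⟩
  obtain ⟨⟨j, s⟩, rfl⟩ := (finProdFinEquiv (m := 2 ^ r) (n := 2)).surjective i
  fin_cases s
  · exact (h j).1
  · exact (h j).2

theorem treeFold_one_le_iff {r : ℕ} {v : Fin (2 ^ r) → ℝ} {c : ℝ} :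
    treeFold 1 r v ≤ c ↔ ∀ i, v i ≤ c := by
  induction r with
  | zero =>
    simp only [treeFold]
    exact ⟨fun h i => by rwa [fin_two_pow_zero i], fun h => h 0⟩
  | succ r ih => simp [treeFold, ih, comb_one, forall_fin_two_pow_succ]

theorem le_treeFold_neg_one_iff {r : ℕ} {v : Fin (2 ^ r) → ℝ} {c : ℝ} :
    c ≤ treeFold (-1) r v ↔ ∀ i, c ≤ v i := by
  induction r with
  | zero =>
    simp only [treeFold]
    exact ⟨fun h i => by rwa [fin_two_pow_zero i], fun h => h 0⟩
  | succ r ih => simp [treeFold, ih, comb_neg_one, forall_fin_two_pow_succ]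

theorem treeFold_nonneg {σ : ℝ} (hσ : σ = 1 ∨ σ = -1) {r : ℕ} {v : Fin (2 ^ r) → ℝ}
    (hv : ∀ i, 0 ≤ v i) : 0 ≤ treeFold σ r v := by
  induction r with
  | zero => exact hv 0
  | succ r ih => exact ih fun i => comb_nonneg hσ (hv _) (hv _)

theorem treeFold_zero (σ : ℝ) (r : ℕ) : treeFold σ r (fun _ => 0) = 0 := by
  induction r with
  | zero => rfl
  | succ r ih => simpa [treeFold, comb_zero_zero] using ih

/-- The nonnegative vectors that vanish outside of `S`. -/
def nonnegOn {J : Type} (S : Finset J) : Set (J → ℝ) :=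
  {v | ∀ j, 0 ≤ v j ∧ (j ∉ S → v j = 0)}

-- The two neurons of a node hold `relu a` and `relu (σ * (b - a))`. As `a ≥ 0`, the first one is
-- `a` itself, so passing `a` through the layer costs a single neuron.
open Classical in
theorem Emulates.comb {J : Type} [Fintype J] [Nonempty J] {m : ℕ} {S : Finset J}
    {F : (J → ℝ) → Fin m → ℝ} {dims : List ℕ} {a b : ℕ} (H : Emulates (nonnegOn S) F dims a b)
    {σ : ℝ} (hσ : σ = 1 ∨ σ = -1) (S' : Finset (J × Fin 2)) (hS : ∀ c ∈ S', c.1 ∈ S) :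
    Emulates (nonnegOn S') (fun v => F fun j => comb σ (v (j, 0)) (v (j, 1)))
      (Fintype.card J * 2 :: dims) (2 * S'.card) (2 * a + b) := by
  -- Columns outside `S'` are set to zero, which is harmless on `nonnegOn S'`. A column in `S'`
  -- meets only the two neurons of its node, hence `nnz A ≤ 2 * S'.card`.
  set A : Matrix (J × Fin 2) (J × Fin 2) ℝ := fun k c =>
    if k.1 = c.1 ∧ c ∈ S' then
      (if k.2 = 0 then (if c.2 = 0 then 1 else 0) else (if c.2 = 0 then -σ else σ)) else 0 with hA
  set B : Matrix J (J × Fin 2) ℝ := fun j c =>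
    if j = c.1 then (if c.2 = 0 then 1 else σ) else 0 with hB
  have hrow : ∀ j, rowNnz B 0 j ≤ 2 := by
    intro j
    rw [rowNnz_zero_right]
    refine (Finset.card_le_card (t := {(j, 0), (j, 1)}) ?_).trans Finset.card_le_two
    rintro ⟨j', s⟩ h
    simp only [Finset.mem_filter, Finset.mem_univ, true_and, hB] at h
    have : j = j' := by by_contra h'; simp [h'] at h
    subst this
    fin_cases s <;> simp
  have hnnz : nnz A ≤ 2 * S'.card := by
    have : nnz A ≤ (S' ×ˢ (Finset.univ : Finset (Fin 2))).card := by
      refine Finset.card_le_card_of_injOn (fun kc => (kc.2, kc.1.2)) ?_ ?_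
      · rintro ⟨k, c⟩ h
        simp only [Finset.coe_filter, Finset.mem_univ, true_and, Set.mem_ofPred_eq, hA, ne_eq,
          ite_eq_right_iff, not_forall] at h
        obtain ⟨h, -⟩ := h
        simp [h.2]
      · rintro ⟨⟨j, s⟩, c⟩ h ⟨⟨j', s'⟩, c'⟩ h' heq
        simp only [Finset.coe_filter, Finset.mem_univ, true_and, Set.mem_ofPred_eq, hA, ne_eq,
          ite_eq_right_iff, not_forall] at h h'
        obtain ⟨h, -⟩ := h
        obtain ⟨h', -⟩ := h'
        simp only [Prod.mk.injEq] at heq ⊢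
        refine ⟨⟨?_, heq.2⟩, heq.1⟩
        rw [h.1, h'.1, heq.1]
    simpa [mul_comm] using this
  have hval : ∀ v ∈ nonnegOn S', B.mulVec (fun i => relu (A.mulVec v i)) =
      fun j => _root_.comb σ (v (j, 0)) (v (j, 1)) := by
    intro v hv
    have hm : ∀ c, (if c ∈ S' then v c else 0) = v c := by
      intro c
      split_ifs with h
      · rfl
      · exact ((hv c).2 h).symm
    have hAv0 : ∀ j, A.mulVec v (j, 0) = v (j, 0) := by
      intro j
      simp only [Matrix.mulVec, dotProduct, hA, Fintype.sum_prod_type, Fin.sum_univ_two]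
      rw [Finset.sum_eq_single j (fun b _ hb => by simp [hb.symm]) (by simp)]
      conv_rhs => rw [← hm]
      simp
    have hAv1 : ∀ j, A.mulVec v (j, 1) = σ * (v (j, 1) - v (j, 0)) := by
      intro j
      simp only [Matrix.mulVec, dotProduct, hA, Fintype.sum_prod_type, Fin.sum_univ_two]
      rw [Finset.sum_eq_single j (fun b _ hb => by simp [hb.symm]) (by simp)]
      conv_rhs => rw [← hm (j, 0), ← hm (j, 1)]
      by_cases h0 : (j, (0 : Fin 2)) ∈ S' <;> by_cases h1 : (j, (1 : Fin 2)) ∈ S' <;>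
        simp [h0, h1]
      ring
    ext j
    simp only [Matrix.mulVec, dotProduct, hB, Fintype.sum_prod_type, Fin.sum_univ_two]
    rw [Finset.sum_eq_single j (fun b _ hb => by simp [hb.symm]) (by simp)]
    have e0 := hAv0 j
    have e1 := hAv1 j
    simp only [Matrix.mulVec, dotProduct, Fintype.sum_prod_type, Fin.sum_univ_two] at e0 e1
    rw [e0, e1]
    simp [_root_.comb, relu, (hv (j, 0)).1]
  have := H.hidden A B hrow (D := nonnegOn S')
    (F := fun v => F fun j => _root_.comb σ (v (j, 0)) (v (j, 1)))
    (fun v hv => by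
      rw [hval v hv]
      refine fun j => ⟨comb_nonneg hσ (hv _).1 (hv _).1, fun hj => ?_⟩
      change _root_.comb σ (v (j, 0)) (v (j, 1)) = 0
      rw [(hv (j, 0)).2 fun h => hj (hS _ h), (hv (j, 1)).2 fun h => hj (hS _ h), comb_zero_zero])
    (fun v hv => by rw [hval v hv])
  rw [Fintype.card_prod, Fintype.card_fin] at this
  exact this.mono hnnz le_rfl

/-- The number of nodes of a binary tree of height `r`, above its root, that have one of the first
`s` leaves below them or are one of these leaves. -/
def treeCount : ℕ → ℕ → ℕ
  | 0, _ => 0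
  | r + 1, s => s + treeCount r ((s + 1) / 2)

/-- The counts halve from level to level; rounding up adds less than one node per level before
summation, which accounts for the `r`. -/
theorem treeCount_le (r s : ℕ) : treeCount r s ≤ 2 * s + r := by
  induction r generalizing s with
  | zero => simp [treeCount]
  | succ r ih =>
    have := ih ((s + 1) / 2)
    simp only [treeCount]
    omega

theorem treeCount_zero (r : ℕ) : treeCount r 0 = 0 := by
  induction r with
  | zero => rfl
  | succ r ih => simpa [treeCount] using ih

/-- A full tree involves no rounding, so the summand `r` of `treeCount_le` disappears. -/
theorem treeCount_two_pow_le (r : ℕ) : treeCount r (2 ^ r) ≤ 2 * 2 ^ r := by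
  induction r with
  | zero => simp [treeCount]
  | succ r ih =>
    have : (2 ^ (r + 1) + 1) / 2 = 2 ^ r := by omega
    simp only [treeCount, this]
    omega

/-- The dimensions of the layers for a family of `N` binary trees of height `r`. -/
def treeDims (N : ℕ) (dims : List ℕ) : ℕ → List ℕ
  | 0 => dims
  | r + 1 => N * 2 ^ r * 2 :: treeDims N dims r

theorem length_treeDims (N : ℕ) (dims : List ℕ) (r : ℕ) :
    (treeDims N dims r).length = dims.length + r := by
  induction r with
  | zero => rfl
  | succ r ih => simp [treeDims, ih]; omega

/-- The first `s j` leaves of the `j`-th tree, for all `j`. -/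
def leaves {J : Type} [Fintype J] (r : ℕ) (s : J → ℕ) : Finset (J × Fin (2 ^ r)) :=
  Finset.univ.filter fun c => (c.2 : ℕ) < s c.1

theorem card_leaves_le {J : Type} [Fintype J] (r : ℕ) (s : J → ℕ) :
    (leaves r s).card ≤ ∑ j, s j := by
  classical
  have : (leaves r s).card ≤ (Finset.univ.sigma fun j => Finset.range (s j)).card := by
    refine Finset.card_le_card_of_injOn (fun c => ⟨c.1, c.2⟩) ?_ ?_
    · intro c hc
      simpa [leaves] using hc
    · rintro ⟨j, i⟩ _ ⟨j', i'⟩ _ h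
      simp only [Sigma.mk.injEq, heq_eq_eq] at h
      ext1
      · exact h.1
      · exact Fin.ext h.2
  simpa using this

/-- The quantity `2 * a + b` is the size bound when the preceding matrix has two nonzero entries per
row, as every tree layer does. A layer with `t` active inputs raises it by at most `4 * t`. -/
theorem Emulates.tree {J : Type} [Fintype J] [Nonempty J] {m : ℕ} {S : Finset J}
    {F : (J → ℝ) → Fin m → ℝ} {dims : List ℕ} {a b : ℕ} (H : Emulates (nonnegOn S) F dims a b)
    {σ : ℝ} (hσ : σ = 1 ∨ σ = -1) (r : ℕ) (s : J → ℕ) (hS : ∀ j, s j ≠ 0 → j ∈ S) :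
    ∃ a' b', Emulates (nonnegOn (leaves r s)) (fun v => F fun j => treeFold σ r fun i => v (j, i))
      (treeDims (Fintype.card J) dims r) a' b' ∧
      2 * a' + b' ≤ 2 * a + b + 4 * ∑ j, treeCount r (s j) := by
  induction r generalizing s with
  | zero =>
    set e : J ≃ J × Fin (2 ^ 0) :=
      ⟨fun j => (j, 0), Prod.fst, fun _ => rfl, fun c => by rw [← fin_two_pow_zero c.2]⟩
    refine ⟨a, b, (H.reindex e).congr ?_ ?_, by simp [treeCount]⟩
    · intro v hv j
      refine ⟨(hv _).1, fun hj => (hv _).2 fun h => hj (hS _ ?_)⟩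
      have : ((0 : Fin (2 ^ 0)) : ℕ) < s j := (Finset.mem_filter.1 h).2
      omega
    · intro v hv
      rfl
  | succ r ih =>
    -- The new layer is added at the leaves. Leaf `2 * i + 0` or `2 * i + 1` feeds node `i`, so the
    -- first `s j` leaves feed the first `⌈s j / 2⌉` nodes.
    obtain ⟨a₁, b₁, H₁, h₁⟩ := ih (fun j => (s j + 1) / 2) fun j hj => hS j (by omega)
    set e : (J × Fin (2 ^ r)) × Fin 2 ≃ J × Fin (2 ^ (r + 1)) :=
      (Equiv.prodAssoc _ _ _).trans (Equiv.prodCongr (Equiv.refl J) finProdFinEquiv) with he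
    have hev : ∀ c, e c = (c.1.1, finProdFinEquiv (c.1.2, c.2)) := fun c => rfl
    have hmem : ∀ c, c ∈ (leaves (r + 1) s).map e.symm.toEmbedding ↔ e c ∈ leaves (r + 1) s := by
      intro c
      rw [Finset.mem_map_equiv]; rfl
    have H₂ := (H₁.comb hσ ((leaves (r + 1) s).map e.symm.toEmbedding) (by
      intro c hc
      rw [hmem, hev] at hc
      have h := (Finset.mem_filter.1 hc).2
      have h' : (c.2 : ℕ) + 2 * c.1.2 < s c.1.1 := h
      refine Finset.mem_filter.2 ⟨Finset.mem_univ _, ?_⟩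
      change (c.1.2 : ℕ) < (s c.1.1 + 1) / 2
      omega)).reindex e
    rw [Fintype.card_prod, Fintype.card_fin] at H₂
    refine ⟨2 * ∑ j, s j, 2 * a₁ + b₁, ((H₂.congr ?_ ?_).mono ?_ le_rfl), ?_⟩
    · intro v hv c
      refine ⟨(hv _).1, fun hc => (hv _).2 fun h => hc ?_⟩
      rwa [hmem]
    · intro v hv
      rfl
    · rw [Finset.card_map]
      have := card_leaves_le (r + 1) s
      omega
    · simp only [treeCount, Finset.sum_add_distrib]
      omega

-- This layer makes the leaf values nonnegative, as the trees require.
open Classical in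
theorem Emulates.relu {J : Type} [Fintype J] [Nonempty J] {m : ℕ} {S : Finset J}
    {F : (J → ℝ) → Fin m → ℝ} {dims : List ℕ} {a b : ℕ} (H : Emulates (nonnegOn S) F dims a b) :
    Emulates {v | ∀ j, j ∉ S → v j = 0} (fun v => F fun j => relu (v j))
      (Fintype.card J :: dims) S.card (2 * a + b) := by
  set A : Matrix J J ℝ := Matrix.diagonal fun j => if j ∈ S then 1 else 0 with hA
  have hrow : ∀ j, rowNnz (1 : Matrix J J ℝ) 0 j ≤ 2 := by
    intro j
    rw [rowNnz_zero_right]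
    refine (Finset.card_le_card (t := {j}) ?_).trans (by simp)
    intro j' h
    by_contra h'
    simp only [Finset.mem_singleton] at h'
    simp [Matrix.one_apply_ne' h'] at h
  have hnnz : nnz A ≤ S.card := by
    refine Finset.card_le_card_of_injOn Prod.fst ?_ ?_
    · rintro ⟨i, j⟩ h
      simp only [Finset.coe_filter, Finset.mem_univ, true_and, Set.mem_ofPred_eq, hA,
        Matrix.diagonal_apply] at h
      by_contra h'
      simp_all
    · rintro ⟨i, j⟩ h ⟨i', j'⟩ h' heq
      simp only [Finset.coe_filter, Finset.mem_univ, true_and, Set.mem_ofPred_eq, hA,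
        Matrix.diagonal_apply] at h h'
      have h1 : i = j := by by_contra h1; simp [h1] at h
      have h2 : i' = j' := by by_contra h1; simp [h1] at h'
      simp only at heq
      rw [← h1, ← h2, heq]
  have hval : ∀ v ∈ {v : J → ℝ | ∀ j, j ∉ S → v j = 0},
      (1 : Matrix J J ℝ).mulVec (fun i => _root_.relu (A.mulVec v i)) =
      fun j => _root_.relu (v j) := by
    intro v hv
    rw [Matrix.one_mulVec]
    ext j
    rw [hA, Matrix.mulVec_diagonal]
    split_ifs with h
    · rw [one_mul]
    · rw [hv j h, mul_zero]
  have := H.hidden A 1 hrow (D := {v | ∀ j, j ∉ S → v j = 0})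
    (F := fun v => F fun j => _root_.relu (v j))
    (fun v hv => by
      rw [hval v hv]
      refine fun j => ⟨le_max_left _ _, fun hj => ?_⟩
      change _root_.relu (v j) = 0
      rw [hv j hj]
      simp [_root_.relu])
    (fun v hv => by rw [hval v hv])
  exact this.mono hnnz le_rfl

end

noncomputable section

/-! ### The architecture and its properties -/

/-- The layer dimensions of a network with `d` inputs and `m` outputs for `N` maxima of `2 ^ k`
minima of `2 ^ l` affine functions. -/
def maxMinDims (d m N k l : ℕ) : List ℕ :=
  d :: N * 2 ^ k * 2 ^ l :: treeDims (N * 2 ^ k) (treeDims N [m] k) l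

theorem length_maxMinDims (d m N k l : ℕ) : (maxMinDims d m N k l).length = k + l + 3 := by
  simp [maxMinDims, length_treeDims]
  omega

theorem exists_maxMin_network {V : Type} [Fintype V] [Nonempty V] {d m k l : ℕ}
    (W : Matrix (Fin m) V ℝ) (s : V → ℕ) (w : V → Fin (2 ^ k) → Fin (2 ^ l) → Fin d → ℝ)
    (c : V → Fin (2 ^ k) → Fin (2 ^ l) → ℝ) :
    ∃ Φ : NeuralNet d m, Φ.IsReLU ∧ Φ.layerDims = maxMinDims d m (Fintype.card V) k l ∧
      Φ.size ≤ (d + 1) * (2 ^ l * ∑ p, s p) + 2 * nnz W + 4 * ∑ p, (2 * s p + k) +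
        8 * (2 ^ l * ∑ p, s p) ∧
      ∀ x, Φ.realization x = W.mulVec fun p => treeFold 1 k fun t =>
        if (t : ℕ) < s p then treeFold (-1) l fun i => relu (w p t i ⬝ᵥ x + c p t i) else 0 := by
  classical
  -- An active leaf of a maximum tree carries a full minimum tree, a padding leaf carries an empty
  -- one.
  set s₁ : V × Fin (2 ^ k) → ℕ := fun q => if q ∈ leaves k s then 2 ^ l else 0 with hs₁
  have hsum : ∑ q, s₁ q ≤ 2 ^ l * ∑ p, s p := by
    have := card_leaves_le k s
    simp only [hs₁, Finset.sum_ite_mem, Finset.univ_inter, Finset.sum_const, smul_eq_mul]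
    rw [mul_comm]
    gcongr
  obtain ⟨a₁, b₁, H₁, h₁⟩ := (emulates_linear W (nonnegOn Finset.univ)).tree (σ := 1) (Or.inl rfl)
    k s fun _ _ => Finset.mem_univ _
  obtain ⟨a₂, b₂, H₂, h₂⟩ := H₁.tree (σ := -1) (Or.inr rfl) l s₁ fun q hq => by
    by_contra h
    simp [hs₁, h] at hq
  have hc₁ : ∑ p, treeCount k (s p) ≤ ∑ p, (2 * s p + k) :=
    Finset.sum_le_sum fun p _ => treeCount_le _ _
  have hc₂ : ∑ q, treeCount l (s₁ q) ≤ 2 * (2 ^ l * ∑ p, s p) := by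
    refine le_trans ?_ (Nat.mul_le_mul_left 2 hsum)
    rw [Finset.mul_sum]
    refine Finset.sum_le_sum fun q _ => ?_
    simp only [hs₁]
    split_ifs
    · exact treeCount_two_pow_le l
    · rw [treeCount_zero]; omega
  have H := H₂.relu
  rw [Fintype.card_prod, Fintype.card_prod, Fintype.card_fin, Fintype.card_fin] at H
  have hmem : ∀ (p : V) (t : Fin (2 ^ k)) (i : Fin (2 ^ l)),
      ((p, t), i) ∈ leaves l s₁ ↔ (t : ℕ) < s p := by
    intro p t i
    have hi := i.2
    simp only [leaves, Finset.mem_filter, Finset.mem_univ, true_and, hs₁]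
    split_ifs with h
    · exact ⟨fun _ => h, fun _ => hi⟩
    · simp [h]
  -- Padding rows vanish, so that the affine map takes values in the domain of `H`. Each row has at
  -- most `d` weights and one bias, hence the factor `d + 1`.
  let B : Matrix ((V × Fin (2 ^ k)) × Fin (2 ^ l)) (Fin d) ℝ :=
    fun q j => if (q.1.2 : ℕ) < s q.1.1 then w q.1.1 q.1.2 q.2 j else 0
  let β : (V × Fin (2 ^ k)) × Fin (2 ^ l) → ℝ :=
    fun q => if (q.1.2 : ℕ) < s q.1.1 then c q.1.1 q.1.2 q.2 else 0
  obtain ⟨Φ, hΦ, hdims, hsize, hval⟩ := H d (d + 1) B β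
    (fun q => (rowNnz_le_card_add_one _ _ q).trans (by rw [Fintype.card_fin]))
  refine ⟨Φ, hΦ, hdims, hsize.trans ?_, fun x => ?_⟩
  · have h3 : (d + 1) * (leaves l s₁).card ≤ (d + 1) * (2 ^ l * ∑ p, s p) :=
      Nat.mul_le_mul_left _ ((card_leaves_le l s₁).trans hsum)
    omega
  · have hx : ∀ q : (V × Fin (2 ^ k)) × Fin (2 ^ l),
        (B.mulVec x + β) q =
        if (q.1.2 : ℕ) < s q.1.1 then w q.1.1 q.1.2 q.2 ⬝ᵥ x + c q.1.1 q.1.2 q.2 else 0 := by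
      intro q
      simp only [Pi.add_apply, Matrix.mulVec, dotProduct, B, β]
      split_ifs <;> simp
    rw [hval x ?_]
    · refine congrArg W.mulVec (funext fun p => congrArg (treeFold 1 k) (funext fun t => ?_))
      simp only [hx]
      split_ifs with h
      · rfl
      · simp only [relu, max_self]
        exact treeFold_zero _ _
    · rintro ⟨⟨p, t⟩, i⟩ hq
      rw [hx, if_neg]
      rwa [← hmem p t i]

namespace NeuralNet

theorem length_layerDims {n m : ℕ} (Φ : NeuralNet n m) : Φ.layerDims.length = Φ.depth + 1 := by
  induction Φ with
  | output A b => rfl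
  | hidden hk A b ϱ Ψ ih => simp [layerDims, depth, ih]

theorem exists_layerDims_eq {n m : ℕ} (Φ : NeuralNet n m) : ∃ k t, Φ.layerDims = n :: k :: t := by
  induction Φ with
  | output A b => exact ⟨_, _, rfl⟩
  | hidden hk A b ϱ Ψ ih =>
    obtain ⟨k, t, h⟩ := ih
    exact ⟨_, _, by rw [layerDims, h]⟩

/-- The activation functions of a ReLU network with layer dimensions `dims` after the input. -/
def reluActivations : List ℕ → List (List (ℝ → ℝ))
  | [] => []
  | [m] => [List.replicate m id]
  | k :: k' :: t => List.replicate k relu :: reluActivations (k' :: t)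

/-- Reduces the claim on activation functions to the one on layer dimensions. -/
theorem IsReLU.activations_eq {n m : ℕ} {Φ : NeuralNet n m} (h : Φ.IsReLU) :
    Φ.activations = reluActivations Φ.layerDims.tail := by
  induction Φ with
  | output A b => rfl
  | hidden hk A b ϱ Ψ ih =>
    obtain ⟨k', t, h'⟩ := Ψ.exists_layerDims_eq
    rw [IsReLU] at h
    have hϱ : ϱ = fun _ => relu := funext h.1
    rw [activations, ih h.2, layerDims, List.tail_cons, h', reluActivations, List.tail_cons, hϱ,
      List.ofFn_const]

end NeuralNet

end

noncomputable section

/-! ### Barycentric coordinates -/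

theorem AffineMap.map_sum_smul {E ι : Type*} [AddCommGroup E] [Module ℝ E] (f : E →ᵃ[ℝ] ℝ)
    (s : Finset ι) (w : ι → ℝ) (z : ι → E) (hw : ∑ i ∈ s, w i = 1) :
    f (∑ i ∈ s, w i • z i) = ∑ i ∈ s, w i * f (z i) := by
  have h : ∀ y, f y = f.linear y + f 0 := fun y => congrFun f.decomp y
  rw [h, map_sum]
  simp only [map_smul, smul_eq_mul, h (z _), mul_add, Finset.sum_add_distrib]
  rw [← Finset.sum_mul, hw, one_mul]

/-- The functions `lam q`, for `q ∈ T`, are the barycentric coordinates with respect to the vertices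
of the simplex `T`; those for `q ∉ T` vanish. -/
structure IsBarycentric {E : Type*} [AddCommGroup E] [Module ℝ E] (T : Finset E)
    (lam : E → E →ᵃ[ℝ] ℝ) : Prop where
  eq_zero : ∀ q, q ∉ T → lam q = 0
  sum_eq_one : ∀ x, ∑ q ∈ T, lam q x = 1
  sum_smul : ∀ x, ∑ q ∈ T, lam q x • q = x
  apply_self : ∀ q ∈ T, lam q q = 1
  apply_ne : ∀ q, ∀ q' ∈ T, q ≠ q' → lam q q' = 0

theorem exists_isBarycentric {d : ℕ} {T : Finset (Fin d → ℝ)} (hT : T.card = d + 1)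
    (hi : AffineIndependent ℝ (fun a : T => (a : Fin d → ℝ))) : ∃ lam, IsBarycentric T lam := by
  classical
  have htop : affineSpan ℝ (Set.range (fun a : T => (a : Fin d → ℝ))) = ⊤ := by
    rw [hi.affineSpan_eq_top_iff_card_eq_finrank_add_one]
    simp [hT]
  let b : AffineBasis T ℝ (Fin d → ℝ) := ⟨fun a => a, hi, htop⟩
  have hb : ∀ a : T, b a = a := fun a => rfl
  let lam : (Fin d → ℝ) → (Fin d → ℝ) →ᵃ[ℝ] ℝ := fun q => if h : q ∈ T then b.coord ⟨q, h⟩ else 0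
  have hlam : ∀ a : T, lam a = b.coord a := fun a => by simp [lam]
  refine ⟨lam, fun q hq => by simp [lam, hq], fun x => ?_, fun x => ?_, fun q hq => ?_,
    fun q q' hq' hne => ?_⟩
  · rw [← Finset.sum_coe_sort]
    simpa only [hlam] using b.sum_coord_apply_eq_one x
  · rw [← Finset.sum_coe_sort]
    simpa only [hlam, hb] using b.linear_combination_coord_eq_self x
  · have := hlam ⟨q, hq⟩
    simp only at this
    rw [this]
    exact b.coord_apply_eq ⟨q, hq⟩
  · by_cases hq : q ∈ T
    · have := hlam ⟨q, hq⟩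
      simp only at this
      rw [this]
      exact b.coord_apply_ne (i := ⟨q, hq⟩) (j := ⟨q', hq'⟩) (by simpa using hne)
    · simp [lam, hq]

namespace IsBarycentric

variable {E : Type*} [AddCommGroup E] [Module ℝ E] {T : Finset E} {lam : E → E →ᵃ[ℝ] ℝ}

theorem map_eq (h : IsBarycentric T lam) (f : E →ᵃ[ℝ] ℝ) (x : E) :
    f x = ∑ q ∈ T, lam q x * f q := by
  conv_lhs => rw [← h.sum_smul x]
  exact f.map_sum_smul T _ _ (h.sum_eq_one x)

theorem apply_sum (h : IsBarycentric T lam) {w : E → ℝ} (hw : ∑ q ∈ T, w q = 1) {q : E}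
    (hq : q ∈ T) : lam q (∑ y ∈ T, w y • y) = w q := by
  rw [(lam q).map_sum_smul T w (fun y => y) hw, Finset.sum_eq_single q, h.apply_self q hq, mul_one]
  · intro y hy hne
    rw [h.apply_ne q y hy hne.symm, mul_zero]
  · exact fun h' => absurd hq h'

theorem mem_convexHull_iff (h : IsBarycentric T lam) {x : E} :
    x ∈ convexHull ℝ (T : Set E) ↔ ∀ q, 0 ≤ lam q x := by
  rw [Finset.mem_convexHull']
  constructor
  · rintro ⟨w, hw0, hw1, rfl⟩ q
    by_cases hq : q ∈ T
    · rw [h.apply_sum hw1 hq]; exact hw0 q hq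
    · rw [h.eq_zero q hq]; simp
  · exact fun hx => ⟨fun q => lam q x, fun q _ => hx q, h.sum_eq_one x, h.sum_smul x⟩

theorem apply_eq_zero_of_mem_face (h : IsBarycentric T lam) {F : Finset E} (hF : F ⊆ T) {x q : E}
    (hx : x ∈ convexHull ℝ (F : Set E)) (hq : q ∉ F) : lam q x = 0 := by
  obtain ⟨w, hw0, hw1, rfl⟩ := Finset.mem_convexHull'.1 hx
  rw [(lam q).map_sum_smul F w (fun y => y) hw1]
  refine Finset.sum_eq_zero fun y hy => ?_
  rw [h.apply_ne q y (hF hy) (fun h' => hq (h' ▸ hy)), mul_zero]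

/-- A vertex of a simplex is an extreme point. -/
theorem mem_of_mem_convexHull (h : IsBarycentric T lam) {F : Finset E}
    (hF : (F : Set E) ⊆ convexHull ℝ (T : Set E)) {q : E} (hq : q ∈ T)
    (hqF : q ∈ convexHull ℝ (F : Set E)) : q ∈ F := by
  classical
  obtain ⟨w, hw0, hw1, hwq⟩ := Finset.mem_convexHull'.1 hqF
  -- The value `lam q q = 1` is an average of the `lam q y`, so some `y ∈ F` has `lam q y ≥ 1`. As
  -- `y` lies in the simplex, its other coordinates vanish and `y = q`.
  have h1 : ∑ y ∈ F, w y * 1 ≤ ∑ y ∈ F, w y * lam q y := by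
    rw [← (lam q).map_sum_smul F w (fun y => y) hw1, hwq, h.apply_self q hq]
    simp [hw1]
  have h2 : ∃ y ∈ F, 1 ≤ lam q y := by
    by_contra! hlt
    obtain ⟨y, hy, hy'⟩ : ∃ y ∈ F, 0 < w y := by
      by_contra! h'
      have := Finset.sum_nonpos h'
      linarith
    refine absurd h1 (not_le.2 (Finset.sum_lt_sum (fun z hz => ?_) ⟨y, hy, ?_⟩))
    · exact mul_le_mul_of_nonneg_left (hlt z hz).le (hw0 z hz)
    · exact mul_lt_mul_of_pos_left (hlt y hy) hy'
  obtain ⟨y, hy, hy1⟩ := h2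
  have hy0 := h.mem_convexHull_iff.1 (hF hy)
  have hsum := h.sum_eq_one y
  rw [← Finset.add_sum_erase T _ hq] at hsum
  have hz : ∑ z ∈ T.erase q, lam z y = 0 :=
    le_antisymm (by linarith) (Finset.sum_nonneg fun z _ => hy0 z)
  have hz' := (Finset.sum_eq_zero_iff_of_nonneg fun z _ => hy0 z).1 hz
  have : y = q := by
    rw [← h.sum_smul y, ← Finset.add_sum_erase T _ hq,
      Finset.sum_eq_zero fun z hz => by rw [hz' z hz, zero_smul]]
    have : lam q y = 1 := by linarith
    rw [this, one_smul, add_zero]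
  exact this ▸ hy

/-- If two simplices `T` and `T'` meet in a common face only, every point of the face of `T'`
opposite to it is separated from `T` by a facet of `T` that contains the common face. -/
theorem exists_apply_neg {T' : Finset E} {lam' : E → E →ᵃ[ℝ] ℝ} (h : IsBarycentric T lam)
    (h' : IsBarycentric T' lam')
    (hface : ∀ x ∈ convexHull ℝ (T : Set E), x ∈ convexHull ℝ (T' : Set E) →
      ∀ q ∈ T', q ∉ T → lam' q x = 0)
    {w : E → ℝ} (hw0 : ∀ q ∈ T', 0 ≤ w q) (hwT : ∀ q ∈ T, w q = 0) (hw1 : ∑ q ∈ T', w q = 1) :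
    ∃ i ∈ T, i ∉ T' ∧ ∑ q ∈ T', w q * lam i q < 0 := by
  classical
  by_contra! hcon
  set y := fun i => ∑ q ∈ T', w q * lam i q with hy
  set N := ∑ q ∈ T', if q ∈ T then max 0 (-y q) else 0 with hN
  have hN0 : 0 ≤ N := Finset.sum_nonneg fun q _ => by split_ifs <;> simp
  have hN1 : 0 < 1 + N := by linarith
  -- Mass added at the common vertices cancels the negative coordinates there; the others are
  -- nonnegative by `hcon`. The normalized point lies in both simplices, yet keeps positive weight
  -- on vertices of `T'` outside `T`, contradicting `hface`.
  set u : E → ℝ := fun q => (1 + N)⁻¹ * (w q + if q ∈ T then max 0 (-y q) else 0) with hu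
  have hu0 : ∀ q ∈ T', 0 ≤ u q := fun q hq => by
    refine mul_nonneg (by positivity) (add_nonneg (hw0 q hq) ?_)
    split_ifs <;> simp
  have hu1 : ∑ q ∈ T', u q = 1 := by
    simp only [hu]
    rw [← Finset.mul_sum, Finset.sum_add_distrib, hw1, ← hN, inv_mul_cancel₀ hN1.ne']
  have hxT' : ∑ q ∈ T', u q • q ∈ convexHull ℝ (T' : Set E) :=
    Finset.mem_convexHull'.2 ⟨u, hu0, hu1, rfl⟩
  have hxT : ∑ q ∈ T', u q • q ∈ convexHull ℝ (T : Set E) := by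
    rw [h.mem_convexHull_iff]
    intro i
    by_cases hi : i ∈ T
    swap
    · rw [h.eq_zero i hi]; simp
    rw [(lam i).map_sum_smul T' u (fun y => y) hu1]
    simp only [hu, mul_assoc, add_mul]
    rw [← Finset.mul_sum, Finset.sum_add_distrib]
    refine mul_nonneg (by positivity) ?_
    have hδ : ∑ q ∈ T', (if q ∈ T then max 0 (-y q) else 0) * lam i q =
        if i ∈ T' then max 0 (-y i) else 0 := by
      rw [← Finset.sum_ite_eq' T' i fun q => max 0 (-y q)]
      refine Finset.sum_congr rfl fun q _ => ?_
      by_cases hqi : q = i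
      · subst hqi
        simp [hi, h.apply_self]
      · rw [if_neg hqi]
        split_ifs with hq
        · rw [h.apply_ne i q hq (Ne.symm hqi), mul_zero]
        · rw [zero_mul]
    rw [hδ]
    change 0 ≤ y i + _
    split_ifs with hi'
    · have := le_max_right 0 (-y i)
      linarith
    · rw [add_zero]; exact hcon i hi hi'
  have hzero : ∑ q ∈ T', w q = 0 := by
    refine Finset.sum_eq_zero fun q hq => ?_
    by_cases hqT : q ∈ T
    · exact hwT q hqT
    · have := hface _ hxT hxT' q hq hqT
      rw [h'.apply_sum hu1 hq] at this
      simpa [hu, hqT, hN1.ne'] using this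
  linarith

/-- A quantitative version of `IsBarycentric.exists_apply_neg`. -/
theorem exists_pos_forall_exists_apply_le {T' : Finset E} {lam' : E → E →ᵃ[ℝ] ℝ}
    (h : IsBarycentric T lam) (h' : IsBarycentric T' lam')
    (hface : ∀ x ∈ convexHull ℝ (T : Set E), x ∈ convexHull ℝ (T' : Set E) →
      ∀ q ∈ T', q ∉ T → lam' q x = 0) :
    ∃ c > (0 : ℝ), ∀ w : E → ℝ, (∀ q ∈ T', 0 ≤ w q) → (∀ q ∈ T, w q = 0) → ∑ q ∈ T', w q = 1 →
      ∃ i ∈ T, i ∉ T' ∧ ∑ q ∈ T', w q * lam i q ≤ -c := by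
  classical
  set K : Set (T' → ℝ) := stdSimplex ℝ T' ∩ {w | ∀ q : T', (q : E) ∈ T → w q = 0} with hK
  have hKc : IsCompact K := by
    refine (isCompact_stdSimplex ℝ T').inter_right ?_
    simp only [Set.ofPred_forall]
    exact isClosed_iInter fun q => isClosed_iInter fun _ =>
      isClosed_eq (continuous_apply q) continuous_const
  -- The sum of the negative parts is continuous and, by `exists_apply_neg`, positive on the compact
  -- set `K`.
  set g : (T' → ℝ) → ℝ := fun w =>
    ∑ i ∈ T.filter (· ∉ T'), max 0 (-∑ q : T', w q * lam i q) with hg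
  have hgc : Continuous g := by fun_prop
  have hpos : ∀ w ∈ K, 0 < g w := by
    rintro w ⟨⟨hw0, hw1⟩, hwT⟩
    have hext : ∀ q : T', (fun q : E => if hq : q ∈ T' then w ⟨q, hq⟩ else 0) q = w q := by
      intro q; simp
    obtain ⟨i, hi, hi', hlt⟩ := h.exists_apply_neg h' hface
      (w := fun q => if hq : q ∈ T' then w ⟨q, hq⟩ else 0)
      (fun q hq => by simpa [hq] using hw0 ⟨q, hq⟩)
      (fun q hq => by
        split_ifs with hq'
        · exact hwT ⟨q, hq'⟩ hq
        · rfl)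
      (by rw [← Finset.sum_coe_sort]; simpa only [hext] using hw1)
    rw [← Finset.sum_coe_sort] at hlt
    simp only [hext] at hlt
    refine Finset.sum_pos' (fun _ _ => le_max_left _ _) ⟨i, by simp [hi, hi'], ?_⟩
    exact lt_max_of_lt_right (by linarith)
  obtain ⟨c, hc, hcg⟩ := hKc.exists_forall_le' hgc.continuousOn hpos
  -- One of at most `T.card` summands must reach this share of `c`; the `+ 1` makes the
  -- contradiction strict.
  refine ⟨c / (T.card + 1), by positivity, fun w hw0 hwT hw1 => ?_⟩
  have hwK : (fun q : T' => w q) ∈ K := by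
    refine ⟨⟨fun q => hw0 q q.2, ?_⟩, fun q hq => hwT q hq⟩
    rw [← hw1, ← Finset.sum_coe_sort T']
  have hle := hcg _ hwK
  by_contra! hcon
  have hcp : 0 < c / (T.card + 1) := by positivity
  have : g (fun q : T' => w q) ≤ T.card * (c / (T.card + 1)) := by
    refine (Finset.sum_le_card_nsmul _ _ (c / (T.card + 1)) fun i hi => ?_).trans ?_
    · obtain ⟨hi, hi'⟩ := Finset.mem_filter.1 hi
      refine max_le hcp.le ?_
      have := hcon i hi hi'
      rw [← Finset.sum_coe_sort T'] at this
      linarith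
    · rw [nsmul_eq_mul]
      gcongr
      exact Finset.filter_subset _ _
  have h2 : T.card * (c / (T.card + 1)) < c := by
    rw [mul_div_assoc', div_lt_iff₀ (by positivity)]
    nlinarith
  linarith

/-- On a neighbouring simplex `T'`, the minimum of `lam p` and of the `lam p + M * lam i` does not
exceed the barycentric coordinate of `T'`, if `M` is large. -/
theorem eventually_le_or_exists_add_mul_le {T' : Finset E} {lam' : E → E →ᵃ[ℝ] ℝ}
    (h : IsBarycentric T lam) (h' : IsBarycentric T' lam')
    (hface : ∀ x ∈ convexHull ℝ (T : Set E), x ∈ convexHull ℝ (T' : Set E) →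
      ∀ q ∈ T', q ∉ T → lam' q x = 0) (p : E) :
    ∀ᶠ M : ℝ in Filter.atTop, p ∈ T → ∀ x ∈ convexHull ℝ (T' : Set E),
      lam p x ≤ lam' p x ∨ ∃ i ∈ T, i ≠ p ∧ lam p x + M * lam i x ≤ lam' p x := by
  classical
  obtain ⟨c, hc, hcw⟩ := h.exists_pos_forall_exists_apply_le h' hface
  set K := ∑ q ∈ T', |lam p q| with hK
  filter_upwards [Filter.eventually_ge_atTop (K / c)] with M hM hp x hx
  have hμ := h'.mem_convexHull_iff.1 hx
  set σ := ∑ q ∈ T', (if q ∈ T then 0 else lam' q x) with hσ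
  have hσ0 : 0 ≤ σ := Finset.sum_nonneg fun q _ => by split_ifs; exacts [le_rfl, hμ q]
  have hdiff : lam p x - lam' p x ≤ K * σ := by
    -- At common vertices `q`, `lam p q` is 0 or 1, and these terms add up to `lam' p x`. Only
    -- vertices of `T'` outside `T` remain.
    have h1 : lam p x - lam' p x = ∑ q ∈ T', (if q ∈ T then 0 else lam' q x) * lam p q := by
      have h2 : lam' p x = ∑ q ∈ T', if q ∈ T then lam' q x * lam p q else 0 := by
        by_cases hp' : p ∈ T'
        · rw [Finset.sum_eq_single p]
          · simp [hp, h.apply_self]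
          · intro q _ hq
            split_ifs with hqT
            · rw [h.apply_ne p q hqT hq.symm, mul_zero]
            · rfl
          · exact fun hn => absurd hp' hn
        · rw [h'.eq_zero p hp']
          refine (Finset.sum_eq_zero fun q hq => ?_).symm
          split_ifs with hqT
          · rw [h.apply_ne p q hqT (fun hpq => hp' (hpq ▸ hq)), mul_zero]
          · rfl
      rw [h2, h'.map_eq (lam p) x, ← Finset.sum_sub_distrib]
      refine Finset.sum_congr rfl fun q _ => ?_
      split_ifs <;> ring
    rw [h1, hσ, Finset.mul_sum]
    refine Finset.sum_le_sum fun q hq => ?_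
    have h3 : 0 ≤ (if q ∈ T then 0 else lam' q x) := by split_ifs; exacts [le_rfl, hμ q]
    rw [mul_comm]
    refine mul_le_mul_of_nonneg_right ((le_abs_self _).trans ?_) h3
    exact Finset.single_le_sum (f := fun q => |lam p q|) (fun _ _ => abs_nonneg _) hq
  rcases hσ0.eq_or_lt with h0 | hpos
  · left
    rw [← h0, mul_zero] at hdiff
    linarith
  obtain ⟨i, hi, hi', hle⟩ := hcw (fun q => (if q ∈ T then 0 else lam' q x) / σ)
    (fun q _ => div_nonneg (by split_ifs; exacts [le_rfl, hμ q]) hσ0)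
    (fun q hq => by simp [hq]) (by rw [← Finset.sum_div, ← hσ, div_self hpos.ne'])
  have hix : lam i x ≤ -c * σ := by
    have h1 : lam i x = (∑ q ∈ T', (if q ∈ T then 0 else lam' q x) / σ * lam i q) * σ := by
      rw [h'.map_eq (lam i) x, Finset.sum_mul]
      refine Finset.sum_congr rfl fun q hq => ?_
      split_ifs with hqT
      · rw [h.apply_ne i q hqT (fun hiq => hi' (hiq ▸ hq))]; simp
      · field_simp
    rw [h1]
    exact mul_le_mul_of_nonneg_right hle hσ0
  have hcσ : 0 < c * σ := mul_pos hc hpos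
  -- If the separating facet is opposite to `p`, then `lam p x < 0 ≤ lam' p x` already.
  by_cases hip : i = p
  · subst hip
    left
    have := hμ i
    linarith
  · right
    refine ⟨i, hi, hip, ?_⟩
    have hK0 : 0 ≤ K := Finset.sum_nonneg fun _ _ => abs_nonneg _
    have hM0 : 0 ≤ M := le_trans (by positivity) hM
    have h1 : M * lam i x ≤ M * (-c * σ) := mul_le_mul_of_nonneg_left hix hM0
    have h2 : K ≤ M * c := (div_le_iff₀ hc).1 hM
    have h3 : K * σ ≤ M * c * σ := mul_le_mul_of_nonneg_right h2 hσ0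
    linarith

end IsBarycentric

end

noncomputable section

/-! ### Hat functions as maxima of minima of affine functions -/

theorem Finset.exists_fin_enumeration {α : Type*} {S : Finset α} (hS : S.Nonempty) {N : ℕ}
    (hN : S.card ≤ N) :
    ∃ f : Fin N → α, (∀ i, f i ∈ S) ∧ ∀ y ∈ S, ∃ i : Fin N, (i : ℕ) < S.card ∧ f i = y := by
  obtain ⟨y₀, hy₀⟩ := hS
  refine ⟨fun i => if h : (i : ℕ) < S.card then S.equivFin.symm ⟨i, h⟩ else y₀, fun i => ?_,
    fun y hy => ?_⟩
  · dsimp only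
    split_ifs
    exacts [(S.equivFin.symm _).2, hy₀]
  · have hlt := (S.equivFin ⟨y, hy⟩).2
    exact ⟨⟨S.equivFin ⟨y, hy⟩, hlt.trans_le hN⟩, hlt, by simp⟩

theorem AffineMap.eq_dotProduct_add {d : ℕ} (f : (Fin d → ℝ) →ᵃ[ℝ] ℝ) (x : Fin d → ℝ) :
    f x = (fun j => f.linear (Pi.single j 1)) ⬝ᵥ x + f 0 := by
  have h : f x = f.linear x + f 0 := congrFun f.decomp x
  rw [h]
  conv_lhs => rw [pi_eq_sum_univ' x]
  simp [dotProduct, mul_comm]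

theorem openConv_subset_convexHull {d : ℕ} (Y : Finset (Fin d → ℝ)) :
    openConv Y ⊆ convexHull ℝ (Y : Set (Fin d → ℝ)) := by
  rintro x ⟨w, hw0, hw1, hx⟩
  exact Finset.mem_convexHull'.2 ⟨w, fun y hy => (hw0 y hy).le, hw1, hx⟩

theorem convexHull_subset_closure_openConv {d : ℕ} {Y : Finset (Fin d → ℝ)} (hY : Y.Nonempty) :
    convexHull ℝ (Y : Set (Fin d → ℝ)) ⊆ closure (openConv Y) := by
  intro x hx
  obtain ⟨w, hw0, hw1, hwx⟩ := Finset.mem_convexHull'.1 hx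
  have hcard : (0 : ℝ) < Y.card := by exact_mod_cast hY.card_pos
  -- The segment from `x` to the barycentre; all weights are positive for `0 < t < 1`.
  let γ : ℝ → Fin d → ℝ := fun t => ∑ y ∈ Y, ((1 - t) * w y + t * (Y.card : ℝ)⁻¹) • y
  have hγ : Continuous γ := by fun_prop
  have h0 : γ 0 = x := by simp [γ, hwx]
  rw [← h0]
  refine mem_closure_of_tendsto (hγ.tendsto' 0 _ rfl |>.mono_left nhdsWithin_le_nhds)
    (f := γ) (b := nhdsWithin 0 (Set.Ioi 0)) ?_
  filter_upwards [Ioo_mem_nhdsGT (zero_lt_one (α := ℝ))] with t ht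
  refine ⟨fun y => (1 - t) * w y + t * (Y.card : ℝ)⁻¹, fun y hy => ?_, ?_, rfl⟩
  · have := hw0 y hy
    have h1 : 0 < 1 - t := by linarith [ht.2]
    have h2 := ht.1
    positivity
  · rw [Finset.sum_add_distrib, ← Finset.mul_sum, hw1]
    simp only [Finset.sum_const, nsmul_eq_mul]
    field_simp
    ring

namespace RegularMesh

variable {d : ℕ} {Ω : Set (Fin d → ℝ)} (𝒯 : RegularMesh Ω)

theorem exists_barycentric : ∃ lam : Finset (Fin d → ℝ) → (Fin d → ℝ) → (Fin d → ℝ) →ᵃ[ℝ] ℝ,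
    ∀ T ∈ 𝒯.cells, IsBarycentric T (lam T) := by
  choose! lam h using fun T (hT : T ∈ 𝒯.cells) =>
    exists_isBarycentric (𝒯.card_cell T hT) (𝒯.affineIndependent_cell T hT)
  exact ⟨lam, h⟩

theorem cell_nonempty {T : Finset (Fin d → ℝ)} (hT : T ∈ 𝒯.cells) : T.Nonempty := by
  rw [← Finset.card_pos, 𝒯.card_cell T hT]
  omega

theorem mem_vertices {T : Finset (Fin d → ℝ)} (hT : T ∈ 𝒯.cells) {q : Fin d → ℝ} (hq : q ∈ T) :
    q ∈ 𝒯.vertices :=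
  Finset.mem_biUnion.2 ⟨T, hT, hq⟩

theorem convexHull_subset_closure {T : Finset (Fin d → ℝ)} (hT : T ∈ 𝒯.cells) :
    convexHull ℝ (T : Set (Fin d → ℝ)) ⊆ closure Ω := by
  rw [𝒯.closure_eq]
  exact Set.subset_biUnion_of_mem (u := fun T : Finset (Fin d → ℝ) =>
    convexHull ℝ (T : Set (Fin d → ℝ))) hT

theorem exists_cell {x : Fin d → ℝ} (hx : x ∈ closure Ω) :
    ∃ T ∈ 𝒯.cells, x ∈ convexHull ℝ (T : Set (Fin d → ℝ)) := by
  rw [𝒯.closure_eq] at hx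
  simpa using hx

variable {𝒯}

/-- Two simplices meet in the common face spanned by their common vertices. -/
theorem apply_eq_zero_of_mem_inter {T T' : Finset (Fin d → ℝ)} (hT : T ∈ 𝒯.cells)
    (hT' : T' ∈ 𝒯.cells) {lam' : (Fin d → ℝ) → (Fin d → ℝ) →ᵃ[ℝ] ℝ} (h' : IsBarycentric T' lam')
    {x : Fin d → ℝ} (hx : x ∈ convexHull ℝ (T : Set (Fin d → ℝ)))
    (hx' : x ∈ convexHull ℝ (T' : Set (Fin d → ℝ))) {q : Fin d → ℝ} (hq' : q ∈ T') (hq : q ∉ T) :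
    lam' q x = 0 := by
  have hne : T ≠ T' := fun h => hq (h ▸ hq')
  obtain ⟨F, hF, hFeq⟩ := 𝒯.regular T hT T' hT' hne
  obtain ⟨F', hF', hFeq'⟩ := 𝒯.regular T' hT' T hT hne.symm
  rw [Set.inter_comm, hFeq] at hFeq'
  have hxF : x ∈ convexHull ℝ (F' : Set (Fin d → ℝ)) := by
    rw [← hFeq', ← hFeq]
    exact ⟨hx, hx'⟩
  -- `F` and `F'` span the same face. A vertex of `F'` is extreme in `T'`, hence belongs to `F ⊆ T`;
  -- so `q ∉ T` forces `q ∉ F'`.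
  refine h'.apply_eq_zero_of_mem_face hF'.subset hxF fun hqF' => hq (hF.subset ?_)
  refine h'.mem_of_mem_convexHull ?_ hq' ?_
  · exact (subset_convexHull ℝ _).trans (hFeq ▸ Set.inter_subset_right)
  · rw [hFeq']
    exact subset_convexHull ℝ _ hqF'

/-- Links `s(p)`, which counts closed simplices containing `p`, to the cells having `p` as a vertex:
otherwise the coordinate of `p` at `p` itself would vanish on the intersection. -/
theorem mem_of_mem_vertices {T : Finset (Fin d → ℝ)} (hT : T ∈ 𝒯.cells) {p : Fin d → ℝ}
    (hp : p ∈ 𝒯.vertices) (hpT : p ∈ convexHull ℝ (T : Set (Fin d → ℝ))) : p ∈ T := by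
  obtain ⟨T', hT', hpT'⟩ := Finset.mem_biUnion.1 hp
  simp only [id] at hpT'
  obtain ⟨lam', h'⟩ := exists_isBarycentric (𝒯.card_cell T' hT') (𝒯.affineIndependent_cell T' hT')
  by_contra hn
  have := apply_eq_zero_of_mem_inter hT hT' h' hpT (subset_convexHull ℝ _ hpT') hpT' hn
  rw [h'.apply_self p hpT'] at this
  exact one_ne_zero this

theorem exists_forall_le_or_exists_add_mul_le
    {lam : Finset (Fin d → ℝ) → (Fin d → ℝ) → (Fin d → ℝ) →ᵃ[ℝ] ℝ}
    (hlam : ∀ T ∈ 𝒯.cells, IsBarycentric T (lam T)) :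
    ∃ M : ℝ, 0 ≤ M ∧ ∀ T ∈ 𝒯.cells, ∀ T' ∈ 𝒯.cells, ∀ p ∈ T,
      ∀ x ∈ convexHull ℝ (T' : Set (Fin d → ℝ)), lam T p x ≤ lam T' p x ∨
        ∃ i ∈ T, i ≠ p ∧ lam T p x + M * lam T i x ≤ lam T' p x := by
  have h : ∀ᶠ M : ℝ in Filter.atTop, ∀ T ∈ 𝒯.cells, ∀ T' ∈ 𝒯.cells, ∀ p ∈ 𝒯.vertices, p ∈ T →
      ∀ x ∈ convexHull ℝ (T' : Set (Fin d → ℝ)), lam T p x ≤ lam T' p x ∨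
        ∃ i ∈ T, i ≠ p ∧ lam T p x + M * lam T i x ≤ lam T' p x := by
    refine (Filter.eventually_all_finset _).2 fun T hT =>
      (Filter.eventually_all_finset _).2 fun T' hT' =>
      (Filter.eventually_all_finset _).2 fun p _ => ?_
    exact (hlam T hT).eventually_le_or_exists_add_mul_le (hlam T' hT')
      (fun x hx hx' q hq' hq => apply_eq_zero_of_mem_inter hT hT' (hlam T' hT') hx hx' hq' hq) p
  obtain ⟨M, hM, hM0⟩ := (h.and (Filter.eventually_ge_atTop 0)).exists
  exact ⟨M, hM0, fun T hT T' hT' p hp => hM T hT T' hT' p (mem_vertices 𝒯 hT hp) hp⟩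

variable (𝒯)

theorem s_le_sMax {p : Fin d → ℝ} (hp : p ∈ 𝒯.vertices) : 𝒯.s p ≤ 𝒯.sMax :=
  Finset.le_sup (f := 𝒯.s) hp

-- In `s` the bound variable is elaborated as a set, so the filter runs over the image of `cells`
-- under coercion; injectivity of the coercion preserves the count.
open Classical in
theorem s_eq_card (p : Fin d → ℝ) :
    𝒯.s p = (𝒯.cells.filter (fun T : Finset (Fin d → ℝ) =>
      p ∈ convexHull ℝ (T : Set (Fin d → ℝ)))).card := by
  rw [← Finset.card_image_of_injective _ Finset.coe_injective, s]
  congr 1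
  ext S
  simp only [Finset.mem_filter, Finset.mem_image, Finset.bind_def, Finset.pure_def, Finset.mem_sup,
    Finset.mem_singleton]
  constructor
  · rintro ⟨⟨T, hT, rfl⟩, hp⟩
    exact ⟨T, ⟨hT, hp⟩, rfl⟩
  · rintro ⟨T, ⟨hT, hp⟩, rfl⟩
    exact ⟨⟨T, hT, rfl⟩, hp⟩

theorem one_le_s {p : Fin d → ℝ} (hp : p ∈ 𝒯.vertices) : 1 ≤ 𝒯.s p := by
  classical
  obtain ⟨T, hT, hpT⟩ := Finset.mem_biUnion.1 hp
  rw [s_eq_card]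
  exact Finset.card_pos.2 ⟨T, by simpa [hT] using subset_convexHull ℝ _ hpT⟩

/-- A maximum of minima of affine functions that, on each cell, is a barycentric coordinate. -/
theorem exists_maxMin_eq_barycentric {k l : ℕ} (hk : 𝒯.sMax ≤ 2 ^ k) (hl : d + 1 ≤ 2 ^ l)
    {lam : Finset (Fin d → ℝ) → (Fin d → ℝ) → (Fin d → ℝ) →ᵃ[ℝ] ℝ}
    (hlam : ∀ T ∈ 𝒯.cells, IsBarycentric T (lam T)) :
    ∃ (w : 𝒯.vertices → Fin (2 ^ k) → Fin (2 ^ l) → Fin d → ℝ)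
      (c : 𝒯.vertices → Fin (2 ^ k) → Fin (2 ^ l) → ℝ),
      ∀ (p : 𝒯.vertices), ∀ T ∈ 𝒯.cells, ∀ x ∈ convexHull ℝ (T : Set (Fin d → ℝ)),
        treeFold 1 k (fun t => if (t : ℕ) < 𝒯.s p then
          treeFold (-1) l fun i => relu (w p t i ⬝ᵥ x + c p t i) else 0) = lam T p x := by
  classical
  obtain ⟨M, hM0, hM⟩ := exists_forall_le_or_exists_add_mul_le hlam
  have hstar : ∀ p : 𝒯.vertices, ∃ f : Fin (2 ^ k) → Finset (Fin d → ℝ),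
      (∀ t, f t ∈ 𝒯.cells ∧ (p : Fin d → ℝ) ∈ f t) ∧
      ∀ T ∈ 𝒯.cells, (p : Fin d → ℝ) ∈ T → ∃ t : Fin (2 ^ k), (t : ℕ) < 𝒯.s p ∧ f t = T := by
    intro p
    have hcard : (𝒯.cells.filter (fun T : Finset (Fin d → ℝ) =>
        (p : Fin d → ℝ) ∈ convexHull ℝ (T : Set (Fin d → ℝ)))).card = 𝒯.s p :=
      (𝒯.s_eq_card p).symm
    obtain ⟨f, hf, hf'⟩ := Finset.exists_fin_enumeration
      (Finset.card_pos.1 (hcard ▸ 𝒯.one_le_s p.2)) (hcard.trans_le ((𝒯.s_le_sMax p.2).trans hk))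
    rw [hcard] at hf'
    refine ⟨f, fun t => ?_, fun T hT hpT => hf' T ?_⟩
    · obtain ⟨h1, h2⟩ := Finset.mem_filter.1 (hf t)
      exact ⟨h1, mem_of_mem_vertices h1 p.2 h2⟩
    · exact Finset.mem_filter.2 ⟨hT, subset_convexHull ℝ _ hpT⟩
  choose star hstar hstar' using hstar
  have henum : ∀ T ∈ 𝒯.cells, ∃ f : Fin (2 ^ l) → Fin d → ℝ, ∀ y ∈ T, ∃ i, f i = y := by
    intro T hT
    obtain ⟨f, -, hf⟩ := Finset.exists_fin_enumeration (𝒯.cell_nonempty hT) (N := 2 ^ l)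
      (by rwa [𝒯.card_cell T hT])
    exact ⟨f, fun y hy => (hf y hy).imp fun _ h => h.2⟩
  choose! enum henum using henum
  -- The affine pieces of the key formula. Dropping `M` at the vertex `p` leaves `lam p` itself
  -- among them.
  let a : 𝒯.vertices → Fin (2 ^ k) → Fin (2 ^ l) → (Fin d → ℝ) →ᵃ[ℝ] ℝ := fun p t i =>
    lam (star p t) p + (if enum (star p t) i = p then 0 else M) • lam (star p t) (enum (star p t) i)
  refine ⟨fun p t i j => (a p t i).linear (Pi.single j 1), fun p t i => a p t i 0,
    fun p T hT x hx => ?_⟩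
  simp only [← AffineMap.eq_dotProduct_add]
  have hx0 := (hlam T hT).mem_convexHull_iff.1 hx
  apply le_antisymm
  · rw [treeFold_one_le_iff]
    intro t
    split_ifs
    swap
    · exact hx0 p
    have key : ∃ i, a p t i x ≤ lam T p x := by
      rcases hM _ (hstar p t).1 T hT p (hstar p t).2 x hx with h | ⟨q, hq, hqp, h⟩
      · obtain ⟨i, hi⟩ := henum _ (hstar p t).1 _ (hstar p t).2
        exact ⟨i, by simpa [a, hi] using h⟩
      · obtain ⟨i, hi⟩ := henum _ (hstar p t).1 _ hq
        exact ⟨i, by simpa [a, hi, hqp] using h⟩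
    obtain ⟨i, hi⟩ := key
    exact (le_treeFold_neg_one_iff.1 le_rfl i).trans (max_le (hx0 p) hi)
  · by_cases hp : (p : Fin d → ℝ) ∈ T
    · obtain ⟨t, ht, rfl⟩ := hstar' p T hT hp
      refine le_trans ?_ (treeFold_one_le_iff.1 le_rfl t)
      rw [if_pos ht, le_treeFold_neg_one_iff]
      intro i
      refine le_trans ?_ (le_max_right _ _)
      have := hx0 (enum (star p t) i)
      simp only [a, AffineMap.coe_add, AffineMap.coe_smul, Pi.add_apply, Pi.smul_apply, smul_eq_mul,
        le_add_iff_nonneg_right]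
      split_ifs <;> positivity
    · rw [(hlam T hT).eq_zero _ hp]
      refine treeFold_nonneg (Or.inl rfl) fun t => ?_
      split_ifs
      · exact treeFold_nonneg (Or.inr rfl) fun i => le_max_left _ _
      · exact le_rfl

end RegularMesh

end

noncomputable section

/-! ### The hat functions form a basis of `S¹(𝒯, Ω)` -/

theorem exists_lipschitzWith_treeFold {E : Type*} [PseudoMetricSpace E] {σ : ℝ}
    (hσ : σ = 1 ∨ σ = -1) {r : ℕ} {f : Fin (2 ^ r) → E → ℝ}
    (hf : ∀ i, ∃ K, LipschitzWith K (f i)) :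
    ∃ K, LipschitzWith K fun x => treeFold σ r fun i => f i x := by
  induction r with
  | zero => exact hf 0
  | succ r ih =>
    refine ih (f := fun i x => comb σ (f (finProdFinEquiv (i, (0 : Fin 2))) x)
      (f (finProdFinEquiv (i, (1 : Fin 2))) x)) fun i => ?_
    obtain ⟨K, hK⟩ := hf (finProdFinEquiv (i, (0 : Fin 2)))
    obtain ⟨K', hK'⟩ := hf (finProdFinEquiv (i, (1 : Fin 2)))
    rcases hσ with rfl | rfl
    · simp only [comb_one]
      exact ⟨_, hK.max hK'⟩
    · simp only [comb_neg_one]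
      exact ⟨_, hK.min hK'⟩

theorem exists_lipschitzWith_relu_dotProduct_add {d : ℕ} (w : Fin d → ℝ) (c : ℝ) :
    ∃ K, LipschitzWith K fun x : Fin d → ℝ => relu (w ⬝ᵥ x + c) := by
  let L : (Fin d → ℝ) →L[ℝ] ℝ := LinearMap.toContinuousLinearMap
    { toFun := fun x => w ⬝ᵥ x
      map_add' := fun x y => dotProduct_add w x y
      map_smul' := fun a x => dotProduct_smul a w x }
  have h : LipschitzWith (‖L‖₊ + 0) fun x => L x + c := L.lipschitz.add (LipschitzWith.const c)
  exact ⟨_, (LipschitzWith.const (0 : ℝ)).max h⟩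

/-- The weak derivative is the line derivative, bounded by Lipschitz continuity and so in L² of the
bounded set `Ω`. Test functions vanish outside `Ω`, so integration by parts takes place on the whole
space. -/
theorem memH1_of_lipschitzWith {d : ℕ} {Ω : Set (Fin d → ℝ)} (hΩ : IsOpen Ω)
    (hb : Bornology.IsBounded Ω) {K : NNReal} {U u : (Fin d → ℝ) → ℝ} (hU : LipschitzWith K U)
    (hu : ∀ x ∈ Ω, u x = U x) : MemH1 Ω u := by
  have : IsFiniteMeasure (volume.restrict Ω) := isFiniteMeasure_restrict.2 hb.measure_lt_top.ne
  constructor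
  · obtain ⟨C, hC⟩ := hb.isCompact_closure.exists_bound_of_continuousOn hU.continuous.continuousOn
    refine MemLp.ae_eq (f := U) ?_ (MemLp.of_bound hU.continuous.aestronglyMeasurable C ?_)
    · exact (ae_restrict_iff' hΩ.measurableSet).2 (.of_forall fun x hx => (hu x hx).symm)
    · exact (ae_restrict_iff' hΩ.measurableSet).2 (.of_forall fun x hx => hC x (subset_closure hx))
  · intro i
    refine ⟨fun x => lineDeriv ℝ U x (Pi.single i 1),
      MemLp.of_bound (measurable_lineDeriv hU.continuous).aestronglyMeasurable
        (K * ‖(Pi.single i 1 : Fin d → ℝ)‖)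
        (.of_forall fun x => norm_lineDeriv_le_of_lipschitz ℝ hU), fun φ h1 h2 h3 => ?_⟩
    obtain ⟨D, hD⟩ := h1.lipschitzWith_of_hasCompactSupport h2 (by simp)
    have hφ : ∀ x ∉ Ω, φ x = 0 := fun x hx => image_eq_zero_of_notMem_tsupport fun h => hx (h3 h)
    have hφ' : ∀ x ∉ Ω, fderiv ℝ φ x = 0 := fun x hx =>
      image_eq_zero_of_notMem_tsupport fun h => hx (h3 (tsupport_fderiv_subset ℝ h))
    rw [setIntegral_congr_fun hΩ.measurableSet (g := fun x => U x * fderiv ℝ φ x (Pi.single i 1))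
      fun x hx => by simp only [hu x hx],
      setIntegral_eq_integral_of_forall_compl_eq_zero fun x hx => by simp [hφ' x hx],
      setIntegral_eq_integral_of_forall_compl_eq_zero fun x hx => by simp [hφ x hx],
      hU.integral_lineDeriv_mul_eq hD h2, ← integral_neg]
    congr 1
    ext x
    rw [((h1.differentiable (by simp)) x).lineDeriv_eq_fderiv, map_neg]
    ring

namespace RegularMesh

variable {d : ℕ} {Ω : Set (Fin d → ℝ)} {𝒯 : RegularMesh Ω}
  {lam : Finset (Fin d → ℝ) → (Fin d → ℝ) → (Fin d → ℝ) →ᵃ[ℝ] ℝ}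
  {U : 𝒯.vertices → (Fin d → ℝ) → ℝ}

theorem mem_S1_of_lipschitzWith (hΩ : IsOpen Ω) (hb : Bornology.IsBounded Ω) {K : NNReal}
    {V : (Fin d → ℝ) → ℝ} (hV : LipschitzWith K V)
    (hVT : ∀ T ∈ 𝒯.cells, ∃ f : (Fin d → ℝ) →ᵃ[ℝ] ℝ,
      ∀ x ∈ convexHull ℝ (T : Set (Fin d → ℝ)), V x = f x) :
    (⟨fun x => V x, hV.continuous.comp continuous_subtype_val⟩ : C(closure Ω, ℝ)) ∈ S1 𝒯 := by
  refine ⟨memH1_of_lipschitzWith hΩ hb hV fun x hx => ?_, fun T hT => ?_⟩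
  · exact Subtype.val_injective.extend_apply _ _ (⟨x, subset_closure hx⟩ : closure Ω)
  · obtain ⟨f, hf⟩ := hVT T hT
    exact ⟨f, fun x hx => hf x (openConv_subset_convexHull T hx)⟩

/-- Membership in `S1` prescribes `v` on open cells only; continuity and density carry this to the
vertices. -/
theorem exists_affineMap_eq (v : S1 𝒯) {T : Finset (Fin d → ℝ)} (hT : T ∈ 𝒯.cells) :
    ∃ f : (Fin d → ℝ) →ᵃ[ℝ] ℝ, ∀ x : closure Ω,
      (x : Fin d → ℝ) ∈ convexHull ℝ (T : Set (Fin d → ℝ)) → v.1 x = f x := by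
  obtain ⟨f, hf⟩ := v.2.2 T hT
  refine ⟨f, fun x hx => ?_⟩
  have hclosed : IsClosed {x : closure Ω | v.1 x = f x} :=
    isClosed_eq v.1.continuous (f.continuous_of_finiteDimensional.comp continuous_subtype_val)
  refine closure_minimal (s := Subtype.val ⁻¹' openConv T) (fun y hy => hf y hy) hclosed ?_
  rw [closure_subtype, Subtype.image_preimage_coe, Set.inter_eq_right.2
    ((openConv_subset_convexHull T).trans (𝒯.convexHull_subset_closure hT))]
  exact convexHull_subset_closure_openConv (𝒯.cell_nonempty hT) hx

theorem hat_apply_vertex (hlam : ∀ T ∈ 𝒯.cells, IsBarycentric T (lam T))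
    (hU : ∀ (p : 𝒯.vertices), ∀ T ∈ 𝒯.cells, ∀ x ∈ convexHull ℝ (T : Set (Fin d → ℝ)),
      U p x = lam T p x) (p q : 𝒯.vertices) : U p q = if q = p then 1 else 0 := by
  obtain ⟨T, hT, hqT⟩ := Finset.mem_biUnion.1 q.2
  simp only [id] at hqT
  rw [hU p T hT q (subset_convexHull ℝ _ hqT)]
  split_ifs with h
  · subst h
    exact (hlam T hT).apply_self _ hqT
  · exact (hlam T hT).apply_ne _ _ hqT fun h' => h (Subtype.ext h'.symm)

theorem eq_sum_hat (hlam : ∀ T ∈ 𝒯.cells, IsBarycentric T (lam T))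
    (hU : ∀ (p : 𝒯.vertices), ∀ T ∈ 𝒯.cells, ∀ x ∈ convexHull ℝ (T : Set (Fin d → ℝ)),
      U p x = lam T p x) (v : S1 𝒯) (x : closure Ω) :
    v.1 x = ∑ p, v.1 (𝒯.vertexPt p) * U p x := by
  obtain ⟨T, hT, hx⟩ := 𝒯.exists_cell x.2
  obtain ⟨f, hf⟩ := exists_affineMap_eq v hT
  rw [hf x hx, (hlam T hT).map_eq f x, Finset.sum_subset (s₂ := 𝒯.vertices)
    (fun q hq => mem_vertices 𝒯 hT hq) (fun q _ hq => by simp [(hlam T hT).eq_zero q hq]),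
    ← Finset.sum_coe_sort]
  refine Finset.sum_congr rfl fun p _ => ?_
  rw [hU p T hT x hx]
  by_cases hp : (p : Fin d → ℝ) ∈ T
  · rw [hf (𝒯.vertexPt p) (subset_convexHull ℝ _ hp), mul_comm]
    rfl
  · simp [(hlam T hT).eq_zero _ hp]

theorem exists_hat_basis (hΩ : IsOpen Ω) (hb : Bornology.IsBounded Ω)
    (hlam : ∀ T ∈ 𝒯.cells, IsBarycentric T (lam T))
    (hU : ∀ (p : 𝒯.vertices), ∀ T ∈ 𝒯.cells, ∀ x ∈ convexHull ℝ (T : Set (Fin d → ℝ)),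
      U p x = lam T p x) (hLip : ∀ p, ∃ K, LipschitzWith K (U p)) :
    ∃ θ : Module.Basis 𝒯.vertices ℝ (S1 𝒯), ∀ p x, (θ p).1 x = U p x := by
  choose K hK using hLip
  let θ₀ : 𝒯.vertices → S1 𝒯 := fun p =>
    ⟨_, mem_S1_of_lipschitzWith hΩ hb (hK p) fun T hT => ⟨lam T p, hU p T hT⟩⟩
  have hsum : ∀ (c : 𝒯.vertices → ℝ) (x : closure Ω),
      (∑ p, c p • θ₀ p).1 x = ∑ p, c p * U p x := by
    intro c x
    rw [AddSubmonoidClass.coe_finsetSum, ContinuousMap.sum_apply]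
    rfl
  -- Evaluation at the vertices, inverted by nodal interpolation.
  let e : S1 𝒯 ≃ₗ[ℝ] (𝒯.vertices → ℝ) :=
    { toFun := fun v p => v.1 (𝒯.vertexPt p)
      map_add' := fun _ _ => rfl
      map_smul' := fun _ _ => rfl
      invFun := fun c => ∑ p, c p • θ₀ p
      left_inv := fun v => by
        ext x
        rw [hsum, ← eq_sum_hat hlam hU v x]
      right_inv := fun c => by
        ext q
        refine (hsum c _).trans ?_
        simp [vertexPt, hat_apply_vertex hlam hU] }
  refine ⟨Module.Basis.ofEquivFun e, fun p x => ?_⟩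
  rw [Module.Basis.coe_ofEquivFun]
  refine (hsum _ x).trans ?_
  simp [Pi.single_apply]

end RegularMesh

end

noncomputable section

/-! ### Size and depth bounds -/

theorem Nat.clog_two_le_logb_add_one {n : ℕ} (hn : 1 ≤ n) :
    (Nat.clog 2 n : ℝ) ≤ Real.logb 2 n + 1 := by
  have h0 : 0 ≤ Real.logb 2 n := Real.logb_nonneg one_lt_two (by exact_mod_cast hn)
  have h := Real.natCeil_logb_natCast 2 n
  rw [← h]
  exact (Nat.ceil_lt_add_one h0).le

theorem Nat.two_pow_clog_le {n : ℕ} (hn : 2 ≤ n) : 2 ^ Nat.clog 2 n ≤ 2 * n := by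
  have h := Nat.pow_pred_clog_lt_self one_lt_two (x := n) (by omega)
  have hpos : 0 < Nat.clog 2 n := Nat.clog_pos one_lt_two hn
  obtain ⟨m, hm⟩ := Nat.exists_eq_succ_of_ne_zero hpos.ne'
  rw [hm] at h ⊢
  simp only [Nat.pred_succ] at h
  rw [pow_succ]
  omega

theorem Real.logb_two_natCast_le (n : ℕ) (hn : 1 ≤ n) : Real.logb 2 n ≤ n := by
  rw [Real.logb_le_iff_le_rpow one_lt_two (by exact_mod_cast hn), Real.rpow_natCast]
  exact_mod_cast Nat.lt_two_pow_self.le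

/-- The dimensions and hence the architecture of the networks, as functions of the input and output
dimensions and of the numbers `s(p)`. -/
def hatDims (d m : ℕ) (S : Multiset ℕ) : List ℕ :=
  maxMinDims d m S.card (Nat.clog 2 S.sup) (Nat.clog 2 (d + 1))

namespace RegularMesh

variable {d : ℕ} {Ω : Set (Fin d → ℝ)} (𝒯 : RegularMesh Ω)

theorem hatDims_sFamily (m : ℕ) : hatDims d m 𝒯.sFamily =
    maxMinDims d m 𝒯.vertices.card (Nat.clog 2 𝒯.sMax) (Nat.clog 2 (d + 1)) := by
  simp only [hatDims, sFamily, Multiset.card_map, Finset.card_val]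
  rfl

theorem vertices_nonempty (hΩ : Ω.Nonempty) : 𝒯.vertices.Nonempty := by
  obtain ⟨x, hx⟩ := hΩ
  obtain ⟨T, hT, -⟩ := 𝒯.exists_cell (subset_closure hx)
  obtain ⟨q, hq⟩ := 𝒯.cell_nonempty hT
  exact ⟨q, mem_vertices 𝒯 hT hq⟩

theorem one_le_sMax (hΩ : Ω.Nonempty) : 1 ≤ 𝒯.sMax := by
  obtain ⟨p, hp⟩ := 𝒯.vertices_nonempty hΩ
  exact (𝒯.one_le_s hp).trans (𝒯.s_le_sMax hp)

theorem card_vertices_le_sum_s : 𝒯.vertices.card ≤ ∑ p ∈ 𝒯.vertices, 𝒯.s p := by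
  rw [Finset.card_eq_sum_ones]
  exact Finset.sum_le_sum fun p hp => 𝒯.one_le_s hp

theorem size_bound_le (hΩ : Ω.Nonempty) (hd : 1 ≤ d) :
    24 * 𝒯.vertices.card * Real.logb 2 𝒯.sMax + 24 * d ^ 2 * ∑ p ∈ 𝒯.vertices, (𝒯.s p : ℝ) ≤
      48 * d ^ 2 * 𝒯.sMax * 𝒯.vertices.card := by
  have h1 := Real.logb_two_natCast_le _ (𝒯.one_le_sMax hΩ)
  have h2 : ∑ p ∈ 𝒯.vertices, (𝒯.s p : ℝ) ≤ 𝒯.vertices.card * 𝒯.sMax := by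
    have := Finset.sum_le_card_nsmul 𝒯.vertices (fun p => (𝒯.s p : ℝ)) 𝒯.sMax
      fun p hp => by exact_mod_cast 𝒯.s_le_sMax hp
    simpa using this
  have hd' : (1 : ℝ) ≤ (d : ℝ) ^ 2 := one_le_pow₀ (by exact_mod_cast hd)
  have h3 : 24 * 𝒯.vertices.card * Real.logb 2 𝒯.sMax ≤
      24 * (d : ℝ) ^ 2 * (𝒯.vertices.card * 𝒯.sMax) := by
    calc 24 * 𝒯.vertices.card * Real.logb 2 𝒯.sMax ≤ 24 * 𝒯.vertices.card * 𝒯.sMax := by gcongr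
      _ = 24 * 1 * (𝒯.vertices.card * 𝒯.sMax) := by ring
      _ ≤ _ := by gcongr
  have h4 : 24 * (d : ℝ) ^ 2 * ∑ p ∈ 𝒯.vertices, (𝒯.s p : ℝ) ≤
      24 * (d : ℝ) ^ 2 * (𝒯.vertices.card * 𝒯.sMax) := by gcongr
  calc _ ≤ _ := add_le_add h3 h4
    _ = _ := by ring

/-- The hat functions are emulated simultaneously with all networks that compute linear combinations
of them in the output layer. -/
theorem exists_hat_basis_and_networks (hd : 2 ≤ d) (hΩ : IsOpen Ω) (hne : Ω.Nonempty)
    (hb : Bornology.IsBounded Ω) :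
    ∃ θ : Module.Basis 𝒯.vertices ℝ (S1 𝒯),
      (∀ p q : 𝒯.vertices, (θ p).1 (𝒯.vertexPt q) = if q = p then 1 else 0) ∧
      (∀ (v : S1 𝒯) (x : closure Ω), v.1 x = ∑ p, v.1 (𝒯.vertexPt p) * (θ p).1 x) ∧
      ∀ (m : ℕ) (W : Matrix (Fin m) 𝒯.vertices ℝ), nnz W ≤ 𝒯.vertices.card →
        ∃ Φ : NeuralNet d m, Φ.IsReLU ∧
          (∀ (x : closure Ω) (i : Fin m), Φ.realization x i = ∑ p, W i p * (θ p).1 x) ∧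
          (Φ.depth : ℝ) ≤ 8 + Real.logb 2 𝒯.sMax + Real.logb 2 (d + 1) ∧
          (Φ.size : ℝ) ≤ 24 * 𝒯.vertices.card * Real.logb 2 𝒯.sMax +
            24 * d ^ 2 * ∑ p ∈ 𝒯.vertices, (𝒯.s p : ℝ) ∧
          Φ.layerDims = hatDims d m 𝒯.sFamily ∧
          Φ.activations = NeuralNet.reluActivations (hatDims d m 𝒯.sFamily).tail := by
  set k := Nat.clog 2 𝒯.sMax with hk
  set l := Nat.clog 2 (d + 1) with hl
  have hkr : (k : ℝ) ≤ Real.logb 2 𝒯.sMax + 1 :=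
    Nat.clog_two_le_logb_add_one (𝒯.one_le_sMax hne)
  have hlr : (l : ℝ) ≤ Real.logb 2 (d + 1) + 1 := by
    have := Nat.clog_two_le_logb_add_one (n := d + 1) (by omega)
    push_cast at this
    exact this
  obtain ⟨lam, hlam⟩ := 𝒯.exists_barycentric
  obtain ⟨w, c, hwc⟩ := 𝒯.exists_maxMin_eq_barycentric (k := k) (l := l)
    (Nat.le_pow_clog one_lt_two _) (Nat.le_pow_clog one_lt_two _) hlam
  set U : 𝒯.vertices → (Fin d → ℝ) → ℝ := fun p x => treeFold 1 k fun t =>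
    if (t : ℕ) < 𝒯.s p then treeFold (-1) l fun i => relu (w p t i ⬝ᵥ x + c p t i) else 0
  have hLip : ∀ p, ∃ K, LipschitzWith K (U p) := by
    intro p
    refine exists_lipschitzWith_treeFold (Or.inl rfl) fun t => ?_
    split_ifs
    · exact exists_lipschitzWith_treeFold (Or.inr rfl) fun i =>
        exists_lipschitzWith_relu_dotProduct_add _ _
    · exact ⟨0, LipschitzWith.const 0⟩
  obtain ⟨θ, hθ⟩ := exists_hat_basis hΩ hb hlam hwc hLip
  refine ⟨θ, fun p q => ?_, fun v x => ?_, fun m W hW => ?_⟩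
  · rw [hθ]
    exact hat_apply_vertex hlam hwc p q
  · simp only [hθ]
    exact eq_sum_hat hlam hwc v x
  have : Nonempty 𝒯.vertices := (𝒯.vertices_nonempty hne).to_subtype
  obtain ⟨Φ, hΦ, hdims, hsize, hval⟩ := exists_maxMin_network W (fun p => 𝒯.s p) w c
  rw [Fintype.card_coe] at hdims
  have hdims' : Φ.layerDims = hatDims d m 𝒯.sFamily := hdims.trans (𝒯.hatDims_sFamily m).symm
  refine ⟨Φ, hΦ, fun x i => ?_, ?_, ?_, hdims', by rw [hΦ.activations_eq, hdims']⟩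
  · rw [hval]
    simp only [Matrix.mulVec, dotProduct, hθ]
  · have h1 := Φ.length_layerDims
    rw [hdims, length_maxMinDims] at h1
    -- One ReLU layer, `l + k` tree layers and the output layer; rounding up both logarithms adds at
    -- most 2.
    have h2 : Φ.depth = k + l + 2 := by omega
    rw [h2]
    push_cast
    linarith
  · set n := 𝒯.vertices.card
    set S := ∑ p ∈ 𝒯.vertices, 𝒯.s p with hS
    have hS' : ∑ p : 𝒯.vertices, 𝒯.s p = S := Finset.sum_coe_sort 𝒯.vertices 𝒯.s
    have hSr : ∑ p ∈ 𝒯.vertices, (𝒯.s p : ℝ) = S := by rw [hS]; push_cast; rfl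
    rw [Finset.sum_add_distrib, ← Finset.mul_sum, hS'] at hsize
    simp only [Finset.sum_const, Finset.card_univ, Fintype.card_coe, smul_eq_mul] at hsize
    have hnS : (n : ℝ) ≤ S := by exact_mod_cast 𝒯.card_vertices_le_sum_s
    have hpow : ((2 ^ l : ℕ) : ℝ) ≤ 2 * (d + 1) := by
      exact_mod_cast Nat.two_pow_clog_le (n := d + 1) (by omega)
    have hdr : (2 : ℝ) ≤ d := by exact_mod_cast hd
    have hsr : (Φ.size : ℝ) ≤ (d + 1) * ((2 ^ l : ℕ) * S) + 2 * n + 4 * (2 * S + n * k) +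
        8 * ((2 ^ l : ℕ) * S) := by
      have hle : Φ.size ≤ (d + 1) * (2 ^ l * S) + 2 * n + 4 * (2 * S + n * k) +
          8 * (2 ^ l * S) := hsize.trans (by gcongr)
      exact_mod_cast hle
    have hnk : (n : ℝ) * k ≤ n * Real.logb 2 𝒯.sMax + n := by
      have := mul_le_mul_of_nonneg_left hkr (Nat.cast_nonneg (α := ℝ) n)
      linarith
    have hlog : 0 ≤ (n : ℝ) * Real.logb 2 𝒯.sMax :=
      mul_nonneg (Nat.cast_nonneg _)
        (Real.logb_nonneg one_lt_two (by exact_mod_cast 𝒯.one_le_sMax hne))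
    have hS0 : (0 : ℝ) ≤ S := Nat.cast_nonneg _
    -- Since `d ≥ 2`, `2 ^ l ≤ 2 * (d + 1) ≤ 3 * d`. The terms of `hsr` then add up to at most `(6 +
    -- 12 + 3.5) * d ^ 2 * S` plus four times `n log₂ 𝔰`, within the constant 24.
    have hpS : ((2 ^ l : ℕ) : ℝ) * S ≤ 3 * d * S :=
      mul_le_mul_of_nonneg_right (by linarith) hS0
    have hdpS : ((d : ℝ) + 1) * ((2 ^ l : ℕ) * S) ≤ 2 * d * (3 * d * S) :=
      mul_le_mul (by linarith) hpS (by positivity) (by positivity)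
    have hdS : 2 * (d * S : ℝ) ≤ d ^ 2 * S := by
      have := mul_le_mul_of_nonneg_right hdr (mul_nonneg (by linarith : (0 : ℝ) ≤ d) hS0)
      linarith
    have hSS : 2 * (S : ℝ) ≤ d * S := mul_le_mul_of_nonneg_right hdr hS0
    rw [hSr]
    linarith

end RegularMesh

end

theorem proposition5p6 :
    ∃ C > (0 : ℝ), ∃ C' > (0 : ℝ),
    -- layer dimensions and activations, as functions of `d` and the family `(s(p))_{p ∈ 𝒱}` only
    ∃ dims dims₁ : ℕ → Multiset ℕ → List ℕ,
    ∃ acts acts₁ : ℕ → Multiset ℕ → List (List (ℝ → ℝ)),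
    ∀ d : ℕ, 2 ≤ d → ∀ Ω : Set (Fin d → ℝ), IsOpen Ω → IsConnected Ω → Bornology.IsBounded Ω →
    ∀ (𝒯 : RegularMesh Ω) (e : 𝒯.vertices ≃ Fin 𝒯.vertices.card),
      Module.finrank ℝ (S1 𝒯) = 𝒯.vertices.card ∧
      C * 𝒯.vertices.card * Real.logb 2 𝒯.sMax + C * d ^ 2 * ∑ p ∈ 𝒯.vertices, (𝒯.s p : ℝ) ≤
        C' * d ^ 2 * 𝒯.sMax * Module.finrank ℝ (S1 𝒯) ∧
      -- the hat functions form a basis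
      ∃ θ : Module.Basis 𝒯.vertices ℝ (S1 𝒯),
        (∀ p q : 𝒯.vertices, (θ p).1 (𝒯.vertexPt q) = if q = p then 1 else 0) ∧
        -- the network that emulates all hat functions in parallel
        (∃ Φ : NeuralNet d 𝒯.vertices.card,
          Φ.IsReLU ∧
          (∀ (x : closure Ω) (p : 𝒯.vertices), Φ.realization x (e p) = (θ p).1 x) ∧
          (Φ.depth : ℝ) ≤ 8 + Real.logb 2 𝒯.sMax + Real.logb 2 (d + 1) ∧
          (Φ.size : ℝ) ≤ C * 𝒯.vertices.card * Real.logb 2 𝒯.sMax +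
            C * d ^ 2 * ∑ p ∈ 𝒯.vertices, (𝒯.s p : ℝ) ∧
          Φ.layerDims = dims d 𝒯.sFamily ∧
          Φ.activations = acts d 𝒯.sFamily) ∧
        -- the networks that emulate the elements of `S¹(𝒯, Ω)`
        ∃ Φ₁ : S1 𝒯 → NeuralNet d 1,
          (∀ v : S1 𝒯,
            (Φ₁ v).IsReLU ∧
            (∀ x : closure Ω, (Φ₁ v).realization x 0 = v.1 x) ∧
            ((Φ₁ v).depth : ℝ) ≤ 8 + Real.logb 2 𝒯.sMax + Real.logb 2 (d + 1) ∧
            ((Φ₁ v).size : ℝ) ≤ C * 𝒯.vertices.card * Real.logb 2 𝒯.sMax +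
              C * d ^ 2 * ∑ p ∈ 𝒯.vertices, (𝒯.s p : ℝ) ∧
            (Φ₁ v).layerDims = dims₁ d 𝒯.sFamily ∧
            (Φ₁ v).activations = acts₁ d 𝒯.sFamily) ∧
          -- these networks form a vector space, isomorphic to `S¹(𝒯, Ω)` through realization
          ∃ (_ : AddCommGroup (Set.range Φ₁)) (_ : Module ℝ (Set.range Φ₁)),
            (∀ (v w : S1 𝒯) (c : ℝ),
              Set.rangeFactorization Φ₁ v + c • Set.rangeFactorization Φ₁ w =
                Set.rangeFactorization Φ₁ (v + c • w)) ∧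
            ∃ R : Set.range Φ₁ ≃ₗ[ℝ] S1 𝒯,
              ∀ (Ψ : Set.range Φ₁) (x : closure Ω), (R Ψ).1 x = Ψ.1.realization x 0 := by
  refine ⟨24, by norm_num, 48, by norm_num, fun d S => hatDims d S.card S, fun d S => hatDims d 1 S,
    fun d S => NeuralNet.reluActivations (hatDims d S.card S).tail,
    fun d S => NeuralNet.reluActivations (hatDims d 1 S).tail,
    fun d hd Ω hΩ hconn hb 𝒯 e => ?_⟩
  classical
  have hne := hconn.nonempty
  obtain ⟨θ, hθ, hexp, hnet⟩ := 𝒯.exists_hat_basis_and_networks hd hΩ hne hb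
  have hrank : Module.finrank ℝ (S1 𝒯) = 𝒯.vertices.card := by
    rw [Module.finrank_eq_card_basis θ, Fintype.card_coe]
  have hcard : 𝒯.sFamily.card = 𝒯.vertices.card := by simp [RegularMesh.sFamily]
  refine ⟨hrank, ?_, θ, hθ, ?_, ?_⟩
  · rw [hrank]
    exact 𝒯.size_bound_le hne (by omega)
  · have hW : nnz (fun i p => if e p = i then 1 else 0 :
        Matrix (Fin 𝒯.vertices.card) 𝒯.vertices ℝ) ≤ 𝒯.vertices.card := by
      refine le_of_le_of_eq (Finset.card_le_card_of_injOn (t := Finset.univ) Prod.snd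
        (fun _ _ => Finset.mem_univ _) ?_) (by simp)
      rintro ⟨i, p⟩ h ⟨i', p'⟩ h' heq
      simp only [Finset.coe_filter, Finset.mem_univ, true_and, Set.mem_ofPred_eq, ne_eq,
        ite_eq_right_iff, one_ne_zero, imp_false, not_not] at h h'
      simp only at heq
      rw [← h, ← h', heq]
    obtain ⟨Φ, h1, h2, h3, h4, h5, h6⟩ := hnet _ _ hW
    refine ⟨Φ, h1, fun x p => ?_, h3, h4, by simpa only [hcard] using h5,
      by simpa only [hcard] using h6⟩
    rw [h2]
    simp
  · have hnet₁ := fun v : S1 𝒯 => hnet 1 (fun _ p => v.1 (𝒯.vertexPt p)) <| by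
      refine (Finset.card_filter_le _ _).trans ?_
      simp
    choose Φ₁ h1 h2 h3 h4 h5 h6 using hnet₁
    have hreal : ∀ (v : S1 𝒯) (x : closure Ω), (Φ₁ v).realization x 0 = v.1 x := fun v x => by
      rw [h2, hexp v x]
    have hinj : Function.Injective Φ₁ := fun v w h => by
      ext x
      rw [← hreal v x, ← hreal w x, h]
    -- The vector space structure is pulled back along this bijection, which makes it linear by
    -- construction.
    let φ : Set.range Φ₁ ≃ S1 𝒯 := (Equiv.ofInjective Φ₁ hinj).symm
    have hφ : ∀ v, φ (Set.rangeFactorization Φ₁ v) = v := fun v =>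
      (Equiv.ofInjective Φ₁ hinj).symm_apply_apply v
    refine ⟨Φ₁, fun v => ⟨h1 v, hreal v, h3 v, h4 v, h5 v, h6 v⟩, φ.addCommGroup, φ.module ℝ, ?_,
      φ.linearEquiv ℝ, ?_⟩
    · intro v w c
      apply φ.injective
      rw [hφ]
      let _ := φ.addCommGroup
      let _ := φ.module ℝ
      change φ.linearEquiv ℝ (_ + _) = _
      rw [map_add, map_smul]
      exact congrArg₂ (fun a b => a + c • b) (hφ v) (hφ w)
    · rintro ⟨_, v, rfl⟩ x
      rw [hreal]
      exact congrArg (fun u : S1 𝒯 => u.1 x) (hφ v)
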